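/- **Model.** A synchronous radio network is a connected undirected graph $G=(V,E)$ of anonymous nodes that all start in the same slot; $n=|V|$ and $n_u$ is the number of neighbors of $u$. In each slot every node either broadcasts a message or listens, deciding from its private random bits (independent across nodes, with the same distribution) and from what it has perceived so far. A broadcasting node gets no feedback. A listening node receives the message if exactly one neighbor broadcasts, and hears silence if no neighbor broadcasts. If at least two neighbors broadcast, it hears noise when collision detection is available, and silence otherwise. In the designated node setting, the designated node $w$ may run a different program from the other nodes. The algorithm may depend on the bound $N$ (respectively $N_\Delta$) below. **Problem.** Fix a constant $\tilde c\ge 1$. An estimate $\hat n_u$ of $n_u$ is good if $n_u\le \hat n_u\le \tilde c\, n_u$. An algorithm solves *single-hop counting* for $N$ in $t$ slots with probability $p$ if, in every clique with $2\le n\le N$ nodes, with probability at least $p$ all nodes hold one identical good estimate at the end of slot $t$. It solves *designated node counting* for $N_\Delta$ in $t$ slots with probability $p$ if, in every connected network in which every node has at most $N_\Delta$ neighbors and for every node $w$ with $n_w\ge 1$, when $w$ is the designated node, with probability at least $p$ it holds a good estimate of $n_w$ at the end of slot $t$. (Correctness may even be demanded only when $n$, respectively $n_w$, is a power of two.) **Theorem.**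 For every constant $\tilde c\ge 1$: In single-hop networks with at most $N$ nodes, 1. without collision detection, for every constant $p>0$, counting with probability at least $p$ requires $\Omega(\lg N)$ slots; and for every constant $\gamma\ge 1$, counting with probability at least $1-1/N^{\gamma}$ requires $\Omega(\lg^2 N)$ slots; 2. with collision detection, for every constant $p>0$, counting with probability at least $p$ requires $\Omega(\lg\lg N)$ slots. For a designated node in multi-hop networks in which nodes have at most $N_\Delta$ neighbors, 3. without collision detection, for every constant $p>0$, counting with probability at least $p$ requires $\Omega(\lg N_\Delta)$ slots; and for every constant $\gamma\ge 1$, counting with probability at least $1-1/N_\Delta^{\gamma}$ requires $\Omega(\lg^2 N_\Delta)$ slots; 4. with collision detection, for every constant $p>0$, counting with probability at least $p$ requires $\Omega(\lg\lg N_\Delta)$ slots. Here "requires $\Omega(f(N))$ slots" means: there are $\kappa>0$ and $N_0$ (depending only on $\tilde c$ and on $p$ or $\gamma$) such that for all $N\ge N_0$, every algorithm that solves the problem for $N$ in $t$ slots has $t\ge\kappa f(N)$; similarly with $N_\Delta$ in place of $N$. -/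

import Mathlib

open MeasureTheory

namespace RadioCounting

/-- What a node perceives in one slot. `transmitting` is recorded in a slot in which the node itself
broadcasts (it then gets no feedback from the channel). -/
inductive Feedback (M : Type) : Type
  | transmitting : Feedback M
  | silence : Feedback M
  | message (m : M) : Feedback M
  | noise : Feedback M

/-- A randomized distributed algorithm for anonymous nodes. Every node privately draws a seed (its
random bits) with distribution `law`. In each slot, a node with role `r`, seed `s` and perceived
history `h` (oldest entry first) broadcasts the message `m` if `act r s h = some m` and listens if
`act r s h = none`; after the slots recorded in `h` its estimate is `est r s h`, where `none` means
that it has not produced an estimate. (The node's own past actions are determined by `r`, `s`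
and `h`, so they need not be recorded.) -/
structure Algorithm (Role : Type) where
  Msg : Type
  Seed : Type
  seedSpace : MeasurableSpace Seed
  law : Measure Seed
  isProb : IsProbabilityMeasure law
  act : Role → Seed → List (Feedback Msg) → Option Msg
  est : Role → Seed → List (Feedback Msg) → Option ℝ

attribute [instance] Algorithm.seedSpace Algorithm.isProb

/-- The role of a node in a network with a designated node. -/
inductive Role : Type
  | designated : Role
  | ordinary : Role

/-- The number `n_v` of neighbors of `v`. -/
noncomputable def neighborCount {V : Type} (G : SimpleGraph V) (v : V) : ℕ :=
  (G.neighborSet v).ncard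

open Classical in
/-- The feedback of node `v` in a slot in which every node `u` does `a u` (`some m`: broadcast `m`,
`none`: listen). `cd = true` means that collision detection is available. -/
noncomputable def feedback {V M : Type} (cd : Bool) (G : SimpleGraph V) (a : V → Option M) (v : V) :
    Feedback M :=
  if (a v).isSome then .transmitting
  else if h : ∃! u, G.Adj v u ∧ (a u).isSome then .message ((a h.choose).get h.choose_spec.1.2)
  else if cd = true ∧ ∃ u, G.Adj v u ∧ (a u).isSome then .noise
  else .silence

/-- The history perceived by each node during the first `t` slots, when the nodes of the network `G`
have the roles `role` and the seeds `σ`, and all start in the same slot. -/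
noncomputable def history {V R : Type} (A : Algorithm R) (cd : Bool) (G : SimpleGraph V)
    (role : V → R) (σ : V → A.Seed) : ℕ → V → List (Feedback A.Msg)
  | 0, _ => []
  | t + 1, v => history A cd G role σ t v ++
      [feedback cd G (fun u => A.act (role u) (σ u) (history A cd G role σ t u)) v]

/-- The estimate that node `v` holds at the end of slot `t`. -/
noncomputable def estimate {V R : Type} (A : Algorithm R) (cd : Bool) (G : SimpleGraph V)
    (role : V → R) (σ : V → A.Seed) (t : ℕ) (v : V) : Option ℝ :=
  A.est (role v) (σ v) (history A cd G role σ t v)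

/-- `e` approximates the neighbor count `k` within the approximation threshold `c`. -/
def IsGoodEstimate (c : ℝ) (k : ℕ) (e : ℝ) : Prop :=
  (k : ℝ) ≤ e ∧ e ≤ c * (k : ℝ)

/-- The event `E` has probability at least `p`, when all nodes draw their seeds independently. -/
def HappensWithProb {V R : Type} [Fintype V] (A : Algorithm R) (p : ℝ) (E : Set (V → A.Seed)) :
    Prop :=
  MeasurableSet E ∧ ENNReal.ofReal p ≤ (Measure.pi fun _ : V => A.law) E

/-- `A` solves approximate neighbor counting in `t` slots with probability at least `p` in
single-hop networks (cliques) with at most `N` nodes: all nodes hold one identical good estimate.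
Correctness is demanded only if the number of nodes, which is at least two, is a power of two. -/
def SolvesSingleHop (A : Algorithm Unit) (cd : Bool) (c : ℝ) (N t : ℕ) (p : ℝ) : Prop :=
  ∀ (V : Type) [Fintype V], 2 ≤ Fintype.card V → Fintype.card V ≤ N →
    (∃ j : ℕ, Fintype.card V = 2 ^ j) →
    HappensWithProb A p {σ : V → A.Seed | ∃ e : ℝ, ∀ v : V,
      estimate A cd ⊤ (fun _ => ()) σ t v = some e ∧
        IsGoodEstimate c (neighborCount (⊤ : SimpleGraph V) v) e}

open Classical in
/-- `A` solves approximate neighbor counting for a designated node in `t` slots with probability at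
least `p` in (multi-hop) networks in which no node, in particular not the designated one, has more
than `N` neighbors. Correctness is demanded only if the neighbor count of the designated node is a
power of two (in particular positive). -/
def SolvesDesignated (A : Algorithm Role) (cd : Bool) (c : ℝ) (N t : ℕ) (p : ℝ) : Prop :=
  ∀ (V : Type) [Fintype V] (G : SimpleGraph V) (w : V), G.Connected →
    (∀ v, neighborCount G v ≤ N) → (∃ j : ℕ, neighborCount G w = 2 ^ j) →
    HappensWithProb A p {σ : V → A.Seed | ∃ e : ℝ,
      estimate A cd G (fun v => if v = w then Role.designated else Role.ordinary) σ t w = some e ∧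
        IsGoodEstimate c (neighborCount G w) e}

/-- The problem requires `Ω(f(N))` time in the worst case, where `solvable N t` says that some
algorithm, which may depend on `N`, solves the problem with size bound `N` in `t` slots. -/
def RequiresOmega (solvable : ℕ → ℕ → Prop) (f : ℕ → ℝ) : Prop :=
  ∃ κ : ℝ, 0 < κ ∧ ∃ N₀ : ℕ, ∀ N : ℕ, N₀ ≤ N → ∀ t : ℕ, solvable N t → κ * f N ≤ (t : ℝ)

/-- The success probability `1 - 1 / N ^ γ`. -/
noncomputable def highProb (γ : ℝ) (N : ℕ) : ℝ := 1 - 1 / (N : ℝ) ^ γ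

end RadioCounting

/-! Nodes are anonymous. As long as no transmission is clear (exactly one broadcaster), what a node
perceives depends only on its own seed and on a noise/silence pattern `ω` shared by all nodes, not
on the number of nodes. So each `ω` has a size-independent set `A ω` of seeds that broadcast after
it. In a clique with `2 ^ j` nodes, success forces either exactly one seed into some `A ω` with `ω`
shorter than `t`, or an estimate after a silent history to be good for `2 ^ j`. One estimate is good
for at most `D` values of `j` once `c < 2 ^ D` (`ncard_good_le`). Each length has a single pattern
without collision detection, but up to `2 ^ i` patterns of length `i` with it; this is the gap
between logarithmic and doubly logarithmic bounds. For a designated node, stars behave the same way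
after fixing the seed of the center: the leaves are then independent and hear only the center.

Constant success probability (`sum_success_le`): a set of measure `q` contains exactly one of `n`
seeds with probability at most `n q (1 - q) ^ (n - 1)`, which sums to at most 2 over `n = 2 ^ j`.
Adding up the success probabilities for `j = 1, …, L` bounds `p * L` by twice the number of short
patterns plus `D` times the number of patterns of length `t`.

High success probability (`exists_no_clear`, `exp_le_sum_failure`): with at most `L ^ 2 / 20000`
slots, some size `n = 2 ^ (L - k)` has no clear transmission with probability at least `exp (-(3 /
25) L) / 4`. Relative to the scale `k`, sets of low level are avoided by all seeds, and sets of high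
level are hit in both halves of the seeds. A set at distance `d` from the scale costs about `2 ^
(-d)` in the exponent, so averaging over `L / 4` scales finds one of total cost `O(L)` with a small
constant. Since the sets may be correlated, `pi_avoid_cover_ge` replaces independence.

Algorithms need not be measurable, only their success events are; `exists_measurable_model` removes
this obstacle. -/

namespace RadioCounting

/-! ### Replacing arbitrary seed sets by measurable ones -/

/-- Finitely many arbitrary sets can be pulled back to measurable sets by a map `ρ` that is
invisible to measurable events in product spaces. -/
theorem exists_measurable_model {S : Type*} [MeasurableSpace S] (μ : Measure S)
    [IsProbabilityMeasure μ] {ι : Type*} [Finite ι] (C : ι → Set S) :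
    ∃ ρ : S → S, (∀ i, MeasurableSet (ρ ⁻¹' C i)) ∧
      ∀ (V : Type) [Fintype V] (E F : Set (V → S)), MeasurableSet E →
        (∀ σ τ : V → S, (∀ v i, σ v ∈ C i ↔ τ v ∈ C i) → σ ∈ F → τ ∈ F) → E ⊆ F →
        ∀ᵐ σ ∂(Measure.pi fun _ : V => μ), σ ∈ E → (fun v => ρ (σ v)) ∈ F := by
  classical
  set f : S → Set ι := fun s => {i | s ∈ C i} with hf
  obtain ⟨N, ⟨enc⟩⟩ := Finite.exists_equiv_fin (Set ι)
  -- Points are classified by the type `f s`, the set of all `i` with `s ∈ C i`. `H k` is a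
  -- measurable hull of the points of type `k`.
  set H : Set ι → Set S := fun k => toMeasurable μ (f ⁻¹' {k}) with hH
  have hHm : ∀ k, MeasurableSet (H k) := fun k => measurableSet_toMeasurable _ _
  have hp : ∀ s, ∃ n : ℕ, ∃ k ∈ Set.range f, (enc k : ℕ) = n ∧ s ∈ H k := fun s =>
    ⟨_, f s, ⟨s, rfl⟩, rfl, subset_toMeasurable μ _ (by simp)⟩
  have hm : Measurable fun s => Nat.find (hp s) := by
    refine measurable_find hp fun n => ?_
    have : {x | ∃ k ∈ Set.range f, (enc k : ℕ) = n ∧ x ∈ H k} =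
        ⋃ k ∈ {k | k ∈ Set.range f ∧ (enc k : ℕ) = n}, H k := by
      ext x; simp [and_assoc]
    rw [this]
    exact MeasurableSet.biUnion (Set.to_countable _) fun k _ => hHm k
  have hspec : ∀ s, ∃ x, (enc (f x) : ℕ) = Nat.find (hp s) ∧ s ∈ H (f x) := fun s => by
    obtain ⟨_, ⟨x, rfl⟩, h1, h2⟩ := Nat.find_spec (hp s)
    exact ⟨x, h1, h2⟩
  -- `ρ s` is a point of the first occurring type, in a fixed enumeration, whose hull contains `s`.
  -- Its type is therefore a measurable function of `s`.
  choose ρ hρ1 hρ2 using hspec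
  refine ⟨ρ, fun i => ?_, fun V _ E F hE hF hEF => ?_⟩
  · have : ρ ⁻¹' C i = (fun s => Nat.find (hp s)) ⁻¹' {n | ∃ k, (enc k : ℕ) = n ∧ i ∈ k} := by
      ext s
      constructor
      · intro h
        exact ⟨f (ρ s), hρ1 s, h⟩
      · rintro ⟨k, hk, hik⟩
        have : k = f (ρ s) := enc.injective (Fin.ext (hk.trans (hρ1 s).symm))
        rw [this] at hik
        exact hik
    rw [this]
    exact hm (MeasurableSet.of_discrete)
  · set P := Measure.pi fun _ : V => μ with hP
    -- If the types `κ` rule out `F`, the box of fibers misses `E`. The box of hulls has the same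
    -- outer measure as the box of fibers, because the product formula holds for arbitrary sets, so
    -- `E` meets the box of hulls in a null set.
    have key : ∀ κ : V → Set ι, (∀ σ : V → S, (∀ v, f (σ v) = κ v) → σ ∉ F) →
        P (E ∩ Set.univ.pi fun v => H (κ v)) = 0 := by
      intro κ hκ
      have hHpi : MeasurableSet (Set.univ.pi fun v => H (κ v)) :=
        MeasurableSet.univ_pi fun v => hHm _
      have h1 : (Set.univ.pi fun v => f ⁻¹' {κ v}) ⊆ (Set.univ.pi fun v => H (κ v)) \ E := by
        intro σ hσ
        have hσ' : ∀ v, f (σ v) = κ v := fun v => hσ v trivial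
        exact ⟨fun v _ => subset_toMeasurable μ _ (hσ' v), fun h => hκ σ hσ' (hEF h)⟩
      have h2 : P (Set.univ.pi fun v => f ⁻¹' {κ v}) = P (Set.univ.pi fun v => H (κ v)) := by
        simp [hP, Measure.pi_pi, hH, measure_toMeasurable]
      have h3 : P (Set.univ.pi fun v => H (κ v)) ≤ P ((Set.univ.pi fun v => H (κ v)) \ E) :=
        h2 ▸ measure_mono h1
      have h4 := measure_inter_add_sdiff (μ := P) (Set.univ.pi fun v => H (κ v)) hE
      rw [Set.inter_comm]
      have h5 : P ((Set.univ.pi fun v => H (κ v)) \ E) ≠ ⊤ := measure_ne_top _ _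
      have h6 := h4.le.trans h3
      by_contra h7
      exact absurd h6 (not_le.2 (by
        rw [add_comm]
        exact ENNReal.lt_add_right h5 h7))
    have hall : P (⋃ κ ∈ {κ : V → Set ι | ∀ σ : V → S, (∀ v, f (σ v) = κ v) → σ ∉ F},
        E ∩ Set.univ.pi fun v => H (κ v)) = 0 :=
      (measure_biUnion_null_iff (Set.to_countable _)).2 key
    rw [ae_iff]
    refine measure_mono_null ?_ hall
    intro σ hσ
    simp only [Set.mem_ofPred_eq, Classical.not_imp] at hσ
    refine Set.mem_biUnion (x := fun v => f (ρ (σ v))) ?_ ⟨hσ.1, fun v _ => hρ2 _⟩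
    intro τ hτ hτF
    refine hσ.2 (hF τ _ (fun v i => ?_) hτF)
    have := congrArg (fun k : Set ι => i ∈ k) (hτ v)
    exact iff_of_eq this

/-! ### Summing success probabilities over the sizes `2 ^ j` -/

/-- Bounds the probability that exactly one of `n` independent samples lies in `A`. -/
theorem pi_existsUnique_le {S : Type*} [MeasurableSpace S] (μ : Measure S)
    [IsProbabilityMeasure μ] {A : Set S} (hA : MeasurableSet A) (n : ℕ) :
    (Measure.pi fun _ : Fin n => μ).real {σ | ∃! v, σ v ∈ A} ≤
      n * μ.real A * (1 - μ.real A) ^ (n - 1) := by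
  classical
  set P := Measure.pi fun _ : Fin n => μ with hP
  have hsub : {σ : Fin n → S | ∃! v, σ v ∈ A} ⊆
      ⋃ v ∈ (Finset.univ : Finset (Fin n)),
        Set.univ.pi fun u => if u = v then A else Aᶜ := by
    rintro σ ⟨v, hv, huniq⟩
    simp only [Finset.mem_univ, Set.iUnion_true, Set.mem_iUnion]
    refine ⟨v, fun u _ => ?_⟩
    by_cases h : u = v
    · simpa [h] using hv
    · simpa [h] using fun hu => h (huniq u hu)
  refine (measureReal_mono hsub (measure_ne_top _ _)).trans
    ((measureReal_biUnion_finset_le _ _).trans ?_)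
  have : ∀ v ∈ (Finset.univ : Finset (Fin n)),
      P.real (Set.univ.pi fun u => if u = v then A else Aᶜ) ≤
        μ.real A * (1 - μ.real A) ^ (n - 1) := by
    intro v _
    rw [measureReal_def, hP, Measure.pi_pi, ENNReal.toReal_prod,
      ← Finset.mul_prod_erase _ _ (Finset.mem_univ v)]
    have h2 : ∏ x ∈ Finset.univ.erase v, (μ (if x = v then A else Aᶜ)).toReal =
        ∏ x ∈ Finset.univ.erase v, (1 - μ.real A) := by
      refine Finset.prod_congr rfl fun x hx => ?_
      rw [if_neg (Finset.ne_of_mem_erase hx), ← measureReal_def, probReal_compl_eq_one_sub hA]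
    rw [h2, if_pos rfl, Finset.prod_const, Finset.card_erase_of_mem (Finset.mem_univ v),
      Finset.card_univ, Fintype.card_fin, measureReal_def]
  refine (Finset.sum_le_sum this).trans ?_
  simp [mul_assoc]

/-- The sum telescopes. With `x = 1 - q`, the geometric sum gives `q a x ^ (a - 1) ≤ 1 - x ^ a`, so
the term for `2 a` is at most `2 (x ^ a - x ^ (2 a))`. -/
theorem sum_two_pow_mul_pow_le {q : ℝ} (h0 : 0 ≤ q) (h1 : q ≤ 1) (L : ℕ) :
    ∑ j ∈ Finset.Icc 1 L, ((2 ^ j : ℕ) : ℝ) * q * (1 - q) ^ (2 ^ j - 1) ≤ 2 := by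
  have hx0 : 0 ≤ 1 - q := by linarith
  suffices h : ∑ j ∈ Finset.Icc 1 L, ((2 ^ j : ℕ) : ℝ) * q * (1 - q) ^ (2 ^ j - 1) ≤
      2 * (1 - (1 - q) ^ (2 ^ L)) by
    have := pow_nonneg hx0 (2 ^ L)
    linarith
  induction L with
  | zero => simp; linarith
  | succ J ih =>
    rw [Finset.sum_Icc_succ_top (by omega)]
    set a := 2 ^ J with ha
    set x := 1 - q with hx
    have hq : q = 1 - x := by linarith
    have ha1 : 1 ≤ a := Nat.one_le_two_pow
    have hpow : 2 ^ (J + 1) = 2 * a := by rw [pow_succ, mul_comm]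
    have hg : (a : ℝ) * x ^ (a - 1) ≤ ∑ i ∈ Finset.range a, x ^ i := by
      have : ∑ i ∈ Finset.range a, x ^ (a - 1) ≤ ∑ i ∈ Finset.range a, x ^ i :=
        Finset.sum_le_sum fun i hi => pow_le_pow_of_le_one hx0 (by linarith)
          (by have := Finset.mem_range.1 hi; omega)
      simpa using this
    have hg2 : q * ∑ i ∈ Finset.range a, x ^ i = 1 - x ^ a := by
      rw [hq, mul_neg_geom_sum]
    have h3 : q * (a * x ^ (a - 1)) ≤ 1 - x ^ a := hg2 ▸ mul_le_mul_of_nonneg_left hg h0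
    have h4 : x ^ (2 * a - 1) = x ^ a * x ^ (a - 1) := by
      rw [← pow_add]; congr 1; omega
    have h5 : x ^ (2 * a) = x ^ a * x ^ a := by rw [← pow_add]; congr 1; omega
    have h6 := mul_le_mul_of_nonneg_left h3 (pow_nonneg hx0 a)
    rw [hpow, h4, h5]
    rw [Nat.cast_mul, Nat.cast_ofNat]
    linarith

/-- Double counting: the sum is the expected number of indices `j` whose set contains the sample. -/
theorem sum_measureReal_le_of_card_le {S : Type*} [MeasurableSpace S] (μ : Measure S)
    [IsProbabilityMeasure μ] (I : Finset ℕ) (B : ℕ → Set S) (hBm : ∀ j, MeasurableSet (B j))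
    {D : ℕ} (hB : ∀ s, {j | j ∈ I ∧ s ∈ B j}.ncard ≤ D) :
    ∑ j ∈ I, μ.real (B j) ≤ D := by
  classical
  have h1 : ∑ j ∈ I, μ.real (B j) = ∫ s, ∑ j ∈ I, (B j).indicator (fun _ => (1 : ℝ)) s ∂μ := by
    rw [integral_finsetSum _ fun j _ => (integrable_const _).indicator (hBm j)]
    refine Finset.sum_congr rfl fun j _ => ?_
    rw [integral_indicator_const _ (hBm j)]; simp
  have h2 : ∀ s, ∑ j ∈ I, (B j).indicator (fun _ => (1 : ℝ)) s ≤ D := by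
    intro s
    have h3 : ∑ j ∈ I, (B j).indicator (fun _ => (1 : ℝ)) s =
        ((I.filter fun j => s ∈ B j).card : ℝ) := by
      simp [Set.indicator_apply]
    have h4 : {j | j ∈ I ∧ s ∈ B j} = ((I.filter fun j => s ∈ B j : Finset ℕ) : Set ℕ) := by
      ext; simp
    have := hB s
    rw [h4, Set.ncard_coe_finset] at this
    rw [h3]; exact_mod_cast this
  rw [h1]
  calc _ ≤ ∫ _, (D : ℝ) ∂μ := integral_mono
        (integrable_finsetSum _ fun j _ => (integrable_const _).indicator (hBm j))
        (integrable_const _) h2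
    _ = D := by simp

theorem pi_forall_mem {S : Type*} [MeasurableSpace S] (μ : Measure S)
    [IsProbabilityMeasure μ] (B : Set S) (n : ℕ) :
    (Measure.pi fun _ : Fin n => μ).real {σ | ∀ v, σ v ∈ B} = μ.real B ^ n := by
  have : {σ : Fin n → S | ∀ v, σ v ∈ B} = Set.univ.pi fun _ => B := by ext; simp
  rw [this, measureReal_def, Measure.pi_pi]
  simp [measureReal_def]

/-- If success in a network with `2 ^ j` independent nodes requires a clear transmission or that all
seeds lie in one of the sets `B k j`, then the success probabilities sum to a small number. -/
theorem sum_success_le {S : Type*} [MeasurableSpace S] (μ : Measure S) [IsProbabilityMeasure μ]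
    {ι κ : Type*} [Fintype ι] [Fintype κ] (A : ι → Set S) (B : κ → ℕ → Set S) (L D : ℕ)
    (hB : ∀ k s, {j | j ∈ Finset.Icc 1 L ∧ s ∈ B k j}.ncard ≤ D)
    (E : ∀ j : ℕ, Set (Fin (2 ^ j) → S)) (hEm : ∀ j ∈ Finset.Icc 1 L, MeasurableSet (E j))
    (hE : ∀ j ∈ Finset.Icc 1 L, ∀ σ ∈ E j, (∃ i, ∃! v, σ v ∈ A i) ∨ ∃ k, ∀ v, σ v ∈ B k j) :
    ∑ j ∈ Finset.Icc 1 L, (Measure.pi fun _ : Fin (2 ^ j) => μ).real (E j) ≤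
      2 * Fintype.card ι + D * Fintype.card κ := by
  classical
  obtain ⟨ρ, hρm, hρ⟩ := exists_measurable_model μ
    (Sum.elim A (fun x : κ × Finset.Icc 1 L => B x.1 x.2))
  have hAm : ∀ i, MeasurableSet (ρ ⁻¹' A i) := fun i => hρm (Sum.inl i)
  set B' : κ → ℕ → Set S := fun k j => if j ∈ Finset.Icc 1 L then ρ ⁻¹' B k j else ∅ with hB'
  have hBm : ∀ k j, MeasurableSet (B' k j) := fun k j => by
    by_cases hj : j ∈ Finset.Icc 1 L
    · simp only [hB', if_pos hj]; exact hρm (Sum.inr (k, ⟨j, hj⟩))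
    · simp only [hB', if_neg hj]; exact MeasurableSet.empty
  have hB'D : ∀ k s, {j | j ∈ Finset.Icc 1 L ∧ s ∈ B' k j}.ncard ≤ D := fun k s => by
    have : {j | j ∈ Finset.Icc 1 L ∧ s ∈ B' k j} = {j | j ∈ Finset.Icc 1 L ∧ ρ s ∈ B k j} := by
      ext j
      simp only [Set.mem_ofPred_eq, hB']
      refine and_congr_right fun hj => ?_
      rw [if_pos hj]; rfl
    rw [this]; exact hB k (ρ s)
  have hstep : ∀ j ∈ Finset.Icc 1 L, (Measure.pi fun _ : Fin (2 ^ j) => μ).real (E j) ≤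
      ∑ i, (((2 ^ j : ℕ) : ℝ) * μ.real (ρ ⁻¹' A i) * (1 - μ.real (ρ ⁻¹' A i)) ^ (2 ^ j - 1)) +
        ∑ k, μ.real (B' k j) := by
    intro j hj
    set P := Measure.pi fun _ : Fin (2 ^ j) => μ
    have h1 : ∀ᵐ σ ∂P, σ ∈ E j → (fun v => ρ (σ v)) ∈
        {σ : Fin (2 ^ j) → S | (∃ i, ∃! v, σ v ∈ A i) ∨ ∃ k, ∀ v, σ v ∈ B k j} := by
      refine hρ _ (E j) _ (hEm j hj) ?_ (hE j hj)
      intro σ τ h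
      have hA' : ∀ i v, σ v ∈ A i ↔ τ v ∈ A i := fun i v => h v (Sum.inl i)
      have hB' : ∀ k v, σ v ∈ B k j ↔ τ v ∈ B k j := fun k v => h v (Sum.inr (k, ⟨j, hj⟩))
      simp [hA', hB']
    have h2 : P.real (E j) ≤ P.real
        ((⋃ i ∈ (Finset.univ : Finset ι), {σ | ∃! v, σ v ∈ ρ ⁻¹' A i}) ∪
          ⋃ k ∈ (Finset.univ : Finset κ), {σ | ∀ v, σ v ∈ B' k j}) := by
      refine ENNReal.toReal_mono (measure_ne_top _ _) (measure_mono_ae ?_)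
      filter_upwards [h1] with σ hσ hσE
      rcases hσ hσE with ⟨i, hi⟩ | ⟨k, hk⟩
      · left
        simp only [Finset.mem_univ, Set.iUnion_true]
        exact Set.mem_iUnion.2 ⟨i, hi⟩
      · right
        simp only [Finset.mem_univ, Set.iUnion_true]
        refine Set.mem_iUnion.2 ⟨k, fun v => ?_⟩
        simp only [hB', if_pos hj]
        exact hk v
    refine h2.trans ((measureReal_union_le _ _).trans (add_le_add ?_ ?_))
    · exact (measureReal_biUnion_finset_le _ _).trans
        (Finset.sum_le_sum fun i _ => pi_existsUnique_le μ (hAm i) _)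
    · refine (measureReal_biUnion_finset_le _ _).trans (Finset.sum_le_sum fun k _ => ?_)
      rw [pi_forall_mem]
      -- Here it suffices that a single node has its seed in `B' k j`.
      exact pow_le_of_le_one measureReal_nonneg measureReal_le_one (by positivity)
  refine (Finset.sum_le_sum hstep).trans ?_
  rw [Finset.sum_add_distrib, Finset.sum_comm, Finset.sum_comm (t := (Finset.univ : Finset κ))]
  refine add_le_add ?_ ?_
  · refine (Finset.sum_le_sum fun i _ => sum_two_pow_mul_pow_le measureReal_nonneg
      measureReal_le_one L).trans ?_
    simp [mul_comm]
  · refine (Finset.sum_le_sum fun k _ => sum_measureReal_le_of_card_le μ _ _ (hBm k)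
      (hB'D k)).trans ?_
    simp [mul_comm]

/-! ### Avoiding some sets while hitting others -/

theorem one_add_sum_le_prod_one_add {ι : Type*} (s : Finset ι) (w : ι → ℝ)
    (hw : ∀ i ∈ s, 0 ≤ w i) : 1 + ∑ i ∈ s, w i ≤ ∏ i ∈ s, (1 + w i) := by
  classical
  induction s using Finset.induction_on with
  | empty => simp
  | insert a s ha ih =>
    rw [Finset.sum_insert ha, Finset.prod_insert ha]
    have h1 := ih fun i hi => hw i (Finset.mem_insert_of_mem hi)
    have h2 := hw a (Finset.mem_insert_self a s)
    have h3 : 0 ≤ ∑ i ∈ s, w i :=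
      Finset.sum_nonneg fun i hi => hw i (Finset.mem_insert_of_mem hi)
    nlinarith

theorem prod_one_add_half_le {ι : Type*} (s : Finset ι) (y : ι → ℝ)
    (hy : ∀ i ∈ s, 0 ≤ y i) (hsum : ∑ i ∈ s, y i ≤ 1) :
    ∏ i ∈ s, (1 + y i / 2) ≤ 1 + ∑ i ∈ s, y i := by
  have h0 : 0 ≤ ∑ i ∈ s, y i := Finset.sum_nonneg hy
  set Y := ∑ i ∈ s, y i with hY
  have h1 : ∏ i ∈ s, (1 + y i / 2) ≤ Real.exp (Y / 2) := by
    rw [hY, Finset.sum_div, Real.exp_sum]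
    refine Finset.prod_le_prod (fun i hi => by linarith [hy i hi]) fun i _ => ?_
    linarith [Real.add_one_le_exp (y i / 2)]
  have h2 : Real.exp (Y / 2) ≤ 1 / (1 - Y / 2) :=
    Real.exp_bound_div_one_sub_of_interval (by linarith) (by linarith)
  refine h1.trans (h2.trans ?_)
  rw [div_le_iff₀ (by linarith)]
  nlinarith

section Product

variable {S : Type*} [MeasurableSpace S] (μ : Measure S) [IsProbabilityMeasure μ]

theorem measurableSet_cons_section {n : ℕ} {E : Set (Fin (n + 1) → S)} (hE : MeasurableSet E)
    (s : S) : MeasurableSet {τ : Fin n → S | (Fin.cons s τ : Fin (n + 1) → S) ∈ E} := by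
  have : Measurable fun τ : Fin n → S => (Fin.cons s τ : Fin (n + 1) → S) := by
    refine measurable_pi_iff.2 fun i => ?_
    refine Fin.cases ?_ (fun i => ?_) i
    · simp
    · simpa using measurable_pi_apply i
  exact this hE

theorem pi_fin_succ_eq {n : ℕ} {E : Set (Fin (n + 1) → S)} (hE : MeasurableSet E) :
    Measurable (fun s => (Measure.pi fun _ : Fin n => μ)
        {τ : Fin n → S | (Fin.cons s τ : Fin (n + 1) → S) ∈ E}) ∧
      (Measure.pi fun _ : Fin (n + 1) => μ) E = ∫⁻ s, (Measure.pi fun _ : Fin n => μ)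
        {τ : Fin n → S | (Fin.cons s τ : Fin (n + 1) → S) ∈ E} ∂μ := by
  set φ := MeasurableEquiv.piFinSuccAbove (fun _ : Fin (n + 1) => S) 0 with hφ
  have hφm : MeasurePreserving φ (Measure.pi fun _ : Fin (n + 1) => μ)
      (μ.prod (Measure.pi fun _ : Fin n => μ)) :=
    measurePreserving_piFinSuccAbove (fun _ : Fin (n + 1) => μ) 0
  have hE' : MeasurableSet (φ.symm ⁻¹' E) := φ.symm.measurable hE
  have hsec : ∀ s, Prod.mk s ⁻¹' (φ.symm ⁻¹' E) =
      {τ : Fin n → S | (Fin.cons s τ : Fin (n + 1) → S) ∈ E} := by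
    intro s
    ext τ
    have : φ.symm (s, τ) = (Fin.cons s τ : Fin (n + 1) → S) := by
      simp only [hφ]
      exact (Fin.insertNth_zero' s τ)
    simp only [Set.mem_preimage, Set.mem_ofPred_eq, this]
  constructor
  · have := measurable_measure_prodMk_left (ν := Measure.pi fun _ : Fin n => μ) hE'
    simpa only [hsec] using this
  · have h1 : (Measure.pi fun _ : Fin (n + 1) => μ) E =
        (μ.prod (Measure.pi fun _ : Fin n => μ)) (φ.symm ⁻¹' E) := by
      rw [← hφm.measure_preimage_equiv, ← Set.preimage_comp]
      simp
    rw [h1, Measure.prod_apply hE']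
    simp only [hsec]

theorem pi_fin_succ_real_eq {n : ℕ} {E : Set (Fin (n + 1) → S)} (hE : MeasurableSet E) :
    Integrable (fun s => (Measure.pi fun _ : Fin n => μ).real
        {τ : Fin n → S | (Fin.cons s τ : Fin (n + 1) → S) ∈ E}) μ ∧
      (Measure.pi fun _ : Fin (n + 1) => μ).real E = ∫ s, (Measure.pi fun _ : Fin n => μ).real
        {τ : Fin n → S | (Fin.cons s τ : Fin (n + 1) → S) ∈ E} ∂μ := by
  obtain ⟨h1, h2⟩ := pi_fin_succ_eq μ hE
  constructor
  · refine Integrable.of_bound (C := 1) h1.ennreal_toReal.aestronglyMeasurable ?_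
    refine Filter.Eventually.of_forall fun s => ?_
    rw [Real.norm_of_nonneg measureReal_nonneg]
    exact measureReal_le_one
  · simp only [measureReal_def]
    rw [h2, integral_toReal h1.aemeasurable
      (Filter.Eventually.of_forall fun s => measure_lt_top _ _)]

/-- The two halves of the samples are independent and identically distributed. No measurability of
`X` is needed. -/
theorem pi_fin_add_real_eq {m : ℕ} {X : Set (Fin m → S)} :
    (Measure.pi fun _ : Fin (m + m) => μ).real
      {σ | (fun v => σ (Fin.castAdd m v)) ∈ X ∧ (fun v => σ (Fin.natAdd m v)) ∈ X} =
      (Measure.pi fun _ : Fin m => μ).real X ^ 2 := by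
  set f := MeasurableEquiv.piCongrLeft (fun _ : Fin (m + m) => S) finSumFinEquiv with hf
  have hfm : MeasurePreserving f (Measure.pi fun _ : Fin m ⊕ Fin m => μ)
      (Measure.pi fun _ : Fin (m + m) => μ) :=
    measurePreserving_piCongrLeft (fun _ : Fin (m + m) => μ) finSumFinEquiv
  set g := MeasurableEquiv.sumPiEquivProdPi (fun _ : Fin m ⊕ Fin m => S) with hg
  have hgm : MeasurePreserving g (Measure.pi fun _ : Fin m ⊕ Fin m => μ)
      ((Measure.pi fun _ : Fin m => μ).prod (Measure.pi fun _ : Fin m => μ)) :=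
    measurePreserving_sumPiEquivProdPi (fun _ : Fin m ⊕ Fin m => μ)
  rw [sq, ← measureReal_prod_prod, measureReal_def, measureReal_def,
    ← hgm.measure_preimage_equiv, ← hfm.measure_preimage_equiv]
  congr 2
  ext τ
  have h1 : ∀ x, f τ (finSumFinEquiv x) = τ x := fun x =>
    Equiv.piCongrLeft_apply_apply (fun _ : Fin (m + m) => S) finSumFinEquiv τ x
  have h2 : (fun v => f τ (Fin.castAdd m v)) = fun v => τ (Sum.inl v) :=
    funext fun v => h1 (Sum.inl v)
  have h3 : (fun v => f τ (Fin.natAdd m v)) = fun v => τ (Sum.inr v) :=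
    funext fun v => h1 (Sum.inr v)
  simp only [Set.mem_preimage, Set.mem_ofPred_eq, h2, h3]
  rfl

variable {ι : Type*} {A : ι → Set S}

/-- `m` independent samples avoid `H` and hit all sets `A i` with a probability that is bounded
below as if the sets were hit independently, up to an error `α`. -/
theorem pi_avoid_cover_ge (hA : ∀ i, MeasurableSet (A i)) {H : Set S} (hH : MeasurableSet H)
    (J₀ : Finset ι) (q : ι → ℝ) (hq0 : ∀ i, 0 ≤ q i)
    (hq : ∀ i ∈ J₀, q i ≤ μ.real (A i \ H)) {α : ℝ} (hα : 0 < α) (hα1 : α ≤ 1)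
    (hqα : ∑ i ∈ J₀, q i ≤ α) (m : ℕ) : ∀ J ⊆ J₀,
    μ.real Hᶜ ^ m * (∏ i ∈ J, (1 - (1 - α) * (1 - q i / 2) ^ m) - α) ≤
      (Measure.pi fun _ : Fin m => μ).real
        {σ | (∀ v, σ v ∉ H) ∧ ∀ i ∈ J, ∃ v, σ v ∈ A i} := by
  classical
  have hq1 : ∀ i ∈ J₀, q i ≤ 1 := fun i hi => (hq i hi).trans measureReal_le_one
  induction m with
  | zero =>
    intro J _
    rcases J.eq_empty_or_nonempty with rfl | hJ
    · have : {σ : Fin 0 → S | (∀ v, σ v ∉ H) ∧ ∀ i ∈ (∅ : Finset ι), ∃ v, σ v ∈ A i} =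
          Set.univ := by
        ext; simp
      rw [this]
      simp [hα.le]
    -- With no samples every factor equals `α`, so the product over a nonempty `J` is at most `α`.
    -- The subtracted `α` pays for this base case.
    · refine le_trans ?_ measureReal_nonneg
      simp only [pow_zero, mul_one, one_mul, sub_sub_cancel, Finset.prod_const, sub_nonpos]
      exact pow_le_of_le_one hα.le hα1 (Finset.card_pos.2 hJ).ne'
  | succ m ih =>
    intro J hJ
    set P := Measure.pi fun _ : Fin m => μ with hP
    set ρ := μ.real Hᶜ with hρ
    have hρ0 : 0 ≤ ρ := measureReal_nonneg
    have hρ1 : ρ ≤ 1 := measureReal_le_one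
    set u : ι → ℝ := fun i => 1 - (1 - α) * (1 - q i / 2) ^ m with hu
    have huα : ∀ i ∈ J, α ≤ u i := fun i hi => by
      have h1 : (1 - q i / 2) ^ m ≤ 1 :=
        pow_le_one₀ (by linarith [hq1 i (hJ hi)]) (by linarith [hq0 i])
      have := mul_le_mul_of_nonneg_left h1 (sub_nonneg.2 hα1)
      simp only [hu]; linarith
    have hu1 : ∀ i ∈ J, u i ≤ 1 := fun i hi => by
      have h1 : 0 ≤ (1 - q i / 2) ^ m := pow_nonneg (by linarith [hq1 i (hJ hi)]) _
      have := mul_nonneg (sub_nonneg.2 hα1) h1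
      simp only [hu]; linarith
    have hu0 : ∀ i ∈ J, 0 < u i := fun i hi => hα.trans_le (huα i hi)
    -- Deleting `i` from `J` multiplies the product of the `u i` by `1 + w i`. The lower bound `α`
    -- on `u i`, due to the factor `1 - α`, keeps `w i` at most `1 / α`.
    set w : ι → ℝ := fun i => 1 / u i - 1 with hw
    have huw : ∀ i ∈ J, u i * (1 + w i) = 1 := fun i hi => by
      have := (hu0 i hi).ne'
      simp only [hw]; field_simp; ring
    have hw0 : ∀ i ∈ J, 0 ≤ w i := fun i hi => by
      have := (le_div_iff₀ (hu0 i hi)).2 (by linarith [hu1 i hi] : 1 * u i ≤ 1)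
      simp only [hw]; linarith
    have hwα : ∀ i ∈ J, w i ≤ 1 / α := fun i hi => by
      have := one_div_le_one_div_of_le hα (huα i hi)
      simp only [hw]; linarith
    set R := ∏ i ∈ J, u i with hR
    have hR0 : 0 ≤ R := Finset.prod_nonneg fun i hi => (hu0 i hi).le
    set E : Set (Fin (m + 1) → S) := {σ | (∀ v, σ v ∉ H) ∧ ∀ i ∈ J, ∃ v, σ v ∈ A i} with hE
    have hEm : MeasurableSet E := by
      have : E = (⋂ v, (fun σ : Fin (m + 1) → S => σ v) ⁻¹' Hᶜ) ∩
          ⋂ i ∈ J, ⋃ v, (fun σ : Fin (m + 1) → S => σ v) ⁻¹' A i := by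
        ext; simp [hE]
      rw [this]
      refine (MeasurableSet.iInter fun v => measurable_pi_apply v hH.compl).inter ?_
      exact Finset.measurableSet_biInter _ fun i _ =>
        MeasurableSet.iUnion fun v => measurable_pi_apply v (hA i)
    obtain ⟨hint, heq⟩ := pi_fin_succ_real_eq μ hEm
    -- The first sample `s` is exposed. Outside `H` it removes from `J` every set it hits, and the
    -- resulting gain `∏ (1 + w i)` is bounded below by `1 + ∑ w i`. This is linear in the
    -- indicators, so overlaps between the `A i` do no harm after integration.
    set ψ : S → ℝ := fun s => ρ ^ m * (Hᶜ.indicator (fun _ => R - α) s +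
      ∑ i ∈ J, (A i \ H).indicator (fun _ => R * w i) s) with hψ
    have hpt : ∀ s, ψ s ≤ P.real {τ : Fin m → S | (Fin.cons s τ : Fin (m + 1) → S) ∈ E} := by
      intro s
      by_cases hs : s ∈ H
      · refine le_trans (le_of_eq ?_) measureReal_nonneg
        simp [hψ, hs]
      · have hsec : {τ : Fin m → S | (Fin.cons s τ : Fin (m + 1) → S) ∈ E} =
            {τ | (∀ v, τ v ∉ H) ∧ ∀ i ∈ J.filter (fun i => s ∉ A i), ∃ v, τ v ∈ A i} := by
          ext τ
          simp only [hE, Set.mem_ofPred_eq, Fin.forall_fin_succ, Fin.cons_zero, Fin.cons_succ,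
            Fin.exists_fin_succ, Finset.mem_filter, hs, not_false_eq_true, true_and]
          refine and_congr_right fun _ => ?_
          constructor
          · rintro h i ⟨hi, his⟩
            exact (h i hi).resolve_left his
          · intro h i hi
            by_cases his : s ∈ A i
            · exact Or.inl his
            · exact Or.inr (h i ⟨hi, his⟩)
        rw [hsec]
        refine le_trans ?_ (ih _ ((Finset.filter_subset _ _).trans hJ))
        simp only [hψ]
        refine mul_le_mul_of_nonneg_left ?_ (pow_nonneg hρ0 _)
        have h1 : ∑ i ∈ J, (A i \ H).indicator (fun _ => R * w i) s =
            R * ∑ i ∈ J.filter (fun i => s ∈ A i), w i := by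
          rw [Finset.mul_sum, Finset.sum_filter]
          refine Finset.sum_congr rfl fun i _ => ?_
          by_cases his : s ∈ A i <;> simp [his, hs]
        rw [h1, Set.indicator_of_mem (by exact hs)]
        have h2 : R = (∏ i ∈ J.filter (fun i => s ∈ A i), u i) *
            ∏ i ∈ J.filter (fun i => s ∉ A i), u i :=
          (Finset.prod_filter_mul_prod_filter_not J (fun i => s ∈ A i) u).symm
        have h3 : (∏ i ∈ J.filter (fun i => s ∈ A i), u i) *
            (1 + ∑ i ∈ J.filter (fun i => s ∈ A i), w i) ≤ 1 := by
          calc _ ≤ (∏ i ∈ J.filter (fun i => s ∈ A i), u i) *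
                ∏ i ∈ J.filter (fun i => s ∈ A i), (1 + w i) :=
                mul_le_mul_of_nonneg_left (one_add_sum_le_prod_one_add _ _ fun i hi =>
                  hw0 i (Finset.mem_filter.1 hi).1) (Finset.prod_nonneg fun i hi =>
                  (hu0 i (Finset.mem_filter.1 hi).1).le)
            _ = 1 := by
                rw [← Finset.prod_mul_distrib]
                exact Finset.prod_eq_one fun i hi => huw i (Finset.mem_filter.1 hi).1
        have h4 : 0 ≤ ∏ i ∈ J.filter (fun i => s ∉ A i), u i :=
          Finset.prod_nonneg fun i hi => (hu0 i (Finset.mem_filter.1 hi).1).le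
        have h5 := mul_le_mul_of_nonneg_right h3 h4
        have h6 : R * (1 + ∑ i ∈ J.filter (fun i => s ∈ A i), w i) ≤
            ∏ i ∈ J.filter (fun i => s ∉ A i), u i := by
          rw [h2]; linarith
        simp only [hu] at h6 ⊢
        linarith
    have hi1 : Integrable (Hᶜ.indicator fun _ : S => R - α) μ :=
      (integrable_const _).indicator hH.compl
    have hi2 : ∀ i ∈ J, Integrable ((A i \ H).indicator fun _ : S => R * w i) μ := fun i _ =>
      (integrable_const _).indicator ((hA i).diff hH)
    have hψi : Integrable ψ μ :=
      (hi1.add (integrable_finsetSum _ hi2)).const_mul _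
    have hψint : ∫ s, ψ s ∂μ =
        ρ ^ m * (ρ * (R - α) + ∑ i ∈ J, μ.real (A i \ H) * (R * w i)) := by
      simp only [hψ]
      rw [integral_const_mul, integral_add hi1 (integrable_finsetSum _ hi2),
        integral_finsetSum _ hi2, integral_indicator_const _ hH.compl]
      simp only [integral_indicator_const _ ((hA _).diff hH), smul_eq_mul]
      rfl
    rw [heq]
    refine le_trans ?_ (integral_mono hψi hint hpt)
    rw [hψint, pow_succ, mul_assoc]
    refine mul_le_mul_of_nonneg_left ?_ (pow_nonneg hρ0 _)
    -- Passing from `m` to `m + 1` multiplies each factor by `1 + q i * w i / 2`. The halving of `q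
    -- i` is what lets the linear gain dominate this product, by `prod_one_add_half_le`.
    have h7 : ∏ i ∈ J, (1 - (1 - α) * (1 - q i / 2) ^ (m + 1)) =
        R * ∏ i ∈ J, (1 + (q i * w i) / 2) := by
      rw [hR, ← Finset.prod_mul_distrib]
      refine Finset.prod_congr rfl fun i hi => ?_
      have h8 := huw i hi
      have h9 : u i = 1 - (1 - α) * (1 - q i / 2) ^ m := rfl
      rw [pow_succ]
      have h10 : u i * w i = 1 - u i := by linarith
      have : u i * (1 + q i * w i / 2) = u i + q i / 2 * (u i * w i) := by ring
      rw [this, h10, h9]; ring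
    have hsum1 : ∑ i ∈ J, q i * w i ≤ 1 := by
      calc ∑ i ∈ J, q i * w i ≤ ∑ i ∈ J, q i * (1 / α) :=
            Finset.sum_le_sum fun i hi => mul_le_mul_of_nonneg_left (hwα i hi) (hq0 i)
        _ = (∑ i ∈ J, q i) * (1 / α) := by rw [Finset.sum_mul]
        _ ≤ α * (1 / α) := mul_le_mul_of_nonneg_right
            ((Finset.sum_le_sum_of_subset_of_nonneg hJ fun i _ _ => hq0 i).trans hqα)
            (by positivity)
        _ = 1 := by field_simp
    have h11 := prod_one_add_half_le J (fun i => q i * w i)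
      (fun i hi => mul_nonneg (hq0 i) (hw0 i hi)) hsum1
    have h12 : ρ * (R * ∑ i ∈ J, q i * w i) ≤ ∑ i ∈ J, μ.real (A i \ H) * (R * w i) := by
      rw [Finset.mul_sum, Finset.mul_sum]
      refine Finset.sum_le_sum fun i hi => ?_
      have h13 : 0 ≤ R * w i := mul_nonneg hR0 (hw0 i hi)
      have h14 : ρ * q i ≤ μ.real (A i \ H) :=
        (mul_le_of_le_one_left (hq0 i) hρ1).trans (hq i (hJ hi))
      calc ρ * (R * (q i * w i)) = (ρ * q i) * (R * w i) := by ring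
        _ ≤ _ := mul_le_mul_of_nonneg_right h14 h13
    have h15 := mul_le_mul_of_nonneg_left (mul_le_mul_of_nonneg_left h11 hR0) hρ0
    rw [h7]
    linarith

/-- A lower bound for the probability that no `A i` contains exactly one of `2 * m` samples. -/
theorem pi_no_clear_ge (hA : ∀ i, MeasurableSet (A i)) [Fintype ι] [DecidableEq ι] (T : Finset ι)
    (q : ι → ℝ) (hq0 : ∀ i, 0 ≤ q i)
    (hq : ∀ i ∉ T, q i ≤ μ.real (A i \ ⋃ i ∈ T, A i)) {α : ℝ} (hα : 0 < α) (hα1 : α ≤ 1)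
    (hqα : ∑ i ∈ Tᶜ, q i ≤ α) {n m : ℕ} (hn : n = m + m) {b : ℝ} (hb0 : 0 ≤ b)
    (hb : b ≤ μ.real (⋃ i ∈ T, A i)ᶜ ^ m *
      (∏ i ∈ Tᶜ, (1 - (1 - α) * (1 - q i / 2) ^ m) - α)) :
    b ^ 2 ≤ (Measure.pi fun _ : Fin n => μ).real {σ | ∀ i, ¬ ∃! v, σ v ∈ A i} := by
  subst hn
  have h1 := hb.trans (pi_avoid_cover_ge μ hA
    (Finset.measurableSet_biUnion T fun i _ => hA i) Tᶜ q hq0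
    (fun i hi => hq i (Finset.mem_compl.1 hi)) hα hα1 hqα m Tᶜ subset_rfl)
  refine (pow_le_pow_left₀ hb0 h1 2).trans ?_
  rw [← pi_fin_add_real_eq]
  refine measureReal_mono ?_ (measure_ne_top _ _)
  -- Sets with index in `T` contain no sample; every other set contains one sample from each half,
  -- hence at least two.
  rintro σ ⟨⟨h2, h3⟩, h4, h5⟩ i ⟨v, hv, huniq⟩
  by_cases hi : i ∈ T
  · induction v using Fin.addCases with
    | left v => exact h2 v (Set.mem_biUnion hi hv)
    | right v => exact h4 v (Set.mem_biUnion hi hv)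
  · obtain ⟨x, hx⟩ := h3 i (Finset.mem_compl.2 hi)
    obtain ⟨y, hy⟩ := h5 i (Finset.mem_compl.2 hi)
    have h6 := (huniq _ hx).trans (huniq _ hy).symm
    have h7 := congrArg Fin.val h6
    simp only [Fin.val_castAdd, Fin.val_natAdd] at h7
    have := x.2
    omega

end Product

/-! ### Levels of sets and the choice of a scale -/

/-- Any collection `T` of indices can be extended so that each remaining set keeps a large measure
outside the union of the selected ones. -/
theorem exists_closure {S : Type*} [MeasurableSpace S] (μ : Measure S) {ι : Type*}
    [Fintype ι] [DecidableEq ι] (A : ι → Set S) (T : Finset ι) (θ : ℝ) :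
    ∃ T', T ⊆ T' ∧
      μ.real (⋃ i ∈ T', A i) ≤ μ.real (⋃ i ∈ T, A i) + θ * (T' \ T).card ∧
      ∀ i ∉ T', θ ≤ μ.real (A i \ ⋃ i ∈ T', A i) := by
  classical
  obtain ⟨T', hT', hmax⟩ := Finset.exists_max_image
    (Finset.univ.filter fun T' => T ⊆ T' ∧
      μ.real (⋃ i ∈ T', A i) ≤ μ.real (⋃ i ∈ T, A i) + θ * (T' \ T).card)
    Finset.card ⟨T, by simp⟩
  simp only [Finset.mem_filter, Finset.mem_univ, true_and] at hT' hmax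
  refine ⟨T', hT'.1, hT'.2, fun i hi => ?_⟩
  by_contra! hlt
  have hiT : i ∉ T := fun h => hi (hT'.1 h)
  -- Were the new part of `A i` smaller than `θ`, adding `i` would respect the budget and contradict
  -- the maximal cardinality of `T'`.
  have h1 := hmax (insert i T') ⟨hT'.1.trans (Finset.subset_insert _ _), by
    have h2 : (⋃ x ∈ insert i T', A x) = (⋃ x ∈ T', A x) ∪ (A i \ ⋃ x ∈ T', A x) := by
      rw [Finset.set_biUnion_insert, Set.union_sdiff_self, Set.union_comm]
    have h3 : insert i T' \ T = insert i (T' \ T) := Finset.insert_sdiff_of_notMem _ hiT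
    have h4 : i ∉ T' \ T := fun h => hi (Finset.mem_sdiff.1 h).1
    rw [h2, h3, Finset.card_insert_of_notMem h4]
    have := measureReal_union_le (μ := μ) (⋃ x ∈ T', A x) (A i \ ⋃ x ∈ T', A x)
    push_cast
    linarith [hT'.2]⟩
  rw [Finset.card_insert_of_notMem hi] at h1
  omega

/-- The indices can be sorted into levels `1, …, K + 1`, according to the thresholds `θ`. -/
theorem exists_levels {S : Type*} [MeasurableSpace S] (μ : Measure S) [IsFiniteMeasure μ]
    {ι : Type*} [Fintype ι] [DecidableEq ι] (A : ι → Set S) (θ : ℕ → ℝ) (K : ℕ) :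
    ∃ lev : ι → ℕ, (∀ i, 1 ≤ lev i ∧ lev i ≤ K + 1) ∧ ∀ k ≤ K,
      μ.real (⋃ i ∈ Finset.univ.filter (fun i => lev i ≤ k), A i) ≤
        ∑ i ∈ Finset.univ.filter (fun i => lev i ≤ k), θ (lev i) ∧
      (1 ≤ k → ∀ i, k < lev i →
        θ (lev i - 1) ≤ μ.real (A i \ ⋃ i ∈ Finset.univ.filter (fun i => lev i ≤ k), A i)) := by
  induction K with
  | zero =>
    refine ⟨fun _ => 1, by simp, fun k hk => ?_⟩
    obtain rfl : k = 0 := by omega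
    simp
  | succ K ih =>
    obtain ⟨lev, h1, h2⟩ := ih
    set T := Finset.univ.filter (fun i => lev i ≤ K) with hT
    obtain ⟨T', hTT', h3, h4⟩ := exists_closure μ A T (θ (K + 1))
    have hmemT : ∀ i, i ∈ T ↔ lev i ≤ K := fun i => by simp [hT]
    -- Indices outside the closure move to the provisional top level `K + 2`, to be refined by the
    -- next threshold.
    set lev' : ι → ℕ := fun i => if i ∈ T' then lev i else K + 2 with hlev'
    have hin : ∀ i ∈ T', lev' i = lev i := fun i hi => by simp [hlev', hi]
    have hout : ∀ i ∉ T', lev' i = K + 2 := fun i hi => by simp [hlev', hi]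
    have hfil : ∀ k ≤ K, Finset.univ.filter (fun i => lev' i ≤ k) =
        Finset.univ.filter (fun i => lev i ≤ k) := by
      intro k hk
      ext i
      simp only [Finset.mem_filter, Finset.mem_univ, true_and]
      by_cases hi : i ∈ T'
      · rw [hin i hi]
      · rw [hout i hi]
        have : ¬ lev i ≤ K := fun h => hi (hTT' ((hmemT i).2 h))
        omega
    have hfilT' : Finset.univ.filter (fun i => lev' i ≤ K + 1) = T' := by
      ext i
      simp only [Finset.mem_filter, Finset.mem_univ, true_and]
      by_cases hi : i ∈ T'
      · rw [hin i hi]; simp [hi, (h1 i).2]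
      · rw [hout i hi]; simp [hi]
    refine ⟨lev', fun i => ?_, fun k hk => ⟨?_, fun hk1 i hi => ?_⟩⟩
    · by_cases hi : i ∈ T'
      · rw [hin i hi]; have := h1 i; omega
      · rw [hout i hi]; omega
    · rcases hk.lt_or_eq with hk' | rfl
      · rw [hfil k (by omega)]
        refine (h2 k (by omega)).1.trans (le_of_eq (Finset.sum_congr rfl fun i hi => ?_))
        rw [hin i (hTT' ((hmemT i).2 (((Finset.mem_filter.1 hi).2).trans (by omega))))]
      · rw [hfilT', ← Finset.sum_sdiff hTT', add_comm]
        refine h3.trans (add_le_add ((h2 K le_rfl).1.trans (le_of_eq ?_)) (le_of_eq ?_))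
        · exact Finset.sum_congr rfl fun i hi => by rw [hin i (hTT' hi)]
        · have : ∀ i ∈ T' \ T, θ (lev' i) = θ (K + 1) := fun i hi => by
            rw [Finset.mem_sdiff, hmemT] at hi
            rw [hin i hi.1]
            have := (h1 i).2
            congr 1; omega
          rw [Finset.sum_congr rfl this, Finset.sum_const, nsmul_eq_mul, mul_comm]
    · by_cases hiT : i ∈ T'
      · rw [hin i hiT] at hi ⊢
        have hkK : k ≤ K := by have := (h1 i).2; omega
        rw [hfil k hkK]
        exact (h2 k hkK).2 hk1 i hi
      · rw [hout i hiT]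
        refine (h4 i hiT).trans (measureReal_mono ?_ (measure_ne_top _ _))
        refine Set.sdiff_subset_sdiff_right (Set.biUnion_subset_biUnion_left ?_)
        intro x hx
        have : x ∈ Finset.univ.filter (fun i => lev' i ≤ K + 1) := by
          simp only [Finset.mem_filter, Finset.mem_univ, true_and] at hx ⊢
          have hx' := (Finset.mem_filter.1 hx).2
          omega
        rw [hfilT'] at this
        exact this

/-- In truncated subtraction, `(l - k) + (k - l)` is the distance of `k` and `l`; there is one
geometric series on each side of `l`. -/
theorem sum_half_pow_dist_le (K l : ℕ) :
    ∑ k ∈ Finset.Icc 1 K, (1 / 2 : ℝ) ^ ((l - k) + (k - l)) ≤ 4 := by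
  have h1 : ∑ k ∈ Finset.range (l + 1), (1 / 2 : ℝ) ^ (l - k) ≤ 2 := by
    have := Finset.sum_range_reflect (fun i => (1 / 2 : ℝ) ^ i) (l + 1)
    simp only [add_tsub_cancel_right] at this
    rw [this]
    exact sum_geometric_two_le _
  have h2 : ∑ k ∈ Finset.Ico l (l + (K + 1)), (1 / 2 : ℝ) ^ (k - l) ≤ 2 := by
    rw [Finset.sum_Ico_eq_sum_range]
    simp only [add_tsub_cancel_left]
    exact sum_geometric_two_le _
  have h3 : ∑ k ∈ Finset.Icc 1 K, (1 / 2 : ℝ) ^ ((l - k) + (k - l)) ≤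
      ∑ k ∈ Finset.range (l + 1) ∪ Finset.Ico l (l + (K + 1)),
        (1 / 2 : ℝ) ^ ((l - k) + (k - l)) := by
    refine Finset.sum_le_sum_of_subset_of_nonneg (fun k hk => ?_) fun _ _ _ => by positivity
    simp only [Finset.mem_Icc, Finset.mem_union, Finset.mem_range, Finset.mem_Ico] at hk ⊢
    omega
  have h4 := Finset.sum_union_inter (s₁ := Finset.range (l + 1))
    (s₂ := Finset.Ico l (l + (K + 1))) (f := fun k => (1 / 2 : ℝ) ^ ((l - k) + (k - l)))
  have h5 : 0 ≤ ∑ k ∈ Finset.range (l + 1) ∩ Finset.Ico l (l + (K + 1)),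
      (1 / 2 : ℝ) ^ ((l - k) + (k - l)) := Finset.sum_nonneg fun _ _ => by positivity
  have h6 : ∑ k ∈ Finset.range (l + 1), (1 / 2 : ℝ) ^ ((l - k) + (k - l)) =
      ∑ k ∈ Finset.range (l + 1), (1 / 2 : ℝ) ^ (l - k) :=
    Finset.sum_congr rfl fun k hk => by
      rw [Finset.mem_range] at hk
      congr 1; omega
  have h7 : ∑ k ∈ Finset.Ico l (l + (K + 1)), (1 / 2 : ℝ) ^ ((l - k) + (k - l)) =
      ∑ k ∈ Finset.Ico l (l + (K + 1)), (1 / 2 : ℝ) ^ (k - l) :=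
    Finset.sum_congr rfl fun k hk => by
      rw [Finset.mem_Ico] at hk
      congr 1; omega
  linarith

theorem exp_neg_two_mul_le {x : ℝ} (h0 : 0 ≤ x) (h1 : x ≤ 1 / 2) :
    Real.exp (-(2 * x)) ≤ 1 - x := by
  have h2 := Real.add_one_le_exp (2 * x)
  rw [Real.exp_neg, inv_le_comm₀ (Real.exp_pos _) (by linarith)]
  refine le_trans ?_ h2
  rw [inv_le_iff_one_le_mul₀ (by linarith)]
  nlinarith

/-- With `x = 2 ^ d` it bounds the probability of hitting a set of expected count `2 ^ d` below by
`exp (-2 ^ (-d))`, the same form of cost as for avoided sets. -/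
theorem exp_neg_inv_le {x : ℝ} (hx : 0 < x) : Real.exp (-x⁻¹) ≤ 1 - Real.exp (-x) := by
  have h1 : Real.exp (-x) ≤ 1 / (1 + x) := by
    rw [Real.exp_neg, ← one_div]
    exact one_div_le_one_div_of_le (by linarith) (by linarith [Real.add_one_le_exp x])
  have h2 : Real.exp (-x⁻¹) ≤ 1 / (1 + x⁻¹) := by
    have := inv_pos.2 hx
    rw [Real.exp_neg, ← one_div]
    exact one_div_le_one_div_of_le (by linarith) (by linarith [Real.add_one_le_exp x⁻¹])
  have h3 : 1 / (1 + x⁻¹) = 1 - 1 / (1 + x) := by field_simp; ring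
  linarith

/-- There is a scale at which both the weighted number of indices and `β` are small. -/
theorem exists_good_scale {ι : Type*} [Fintype ι] (lev : ι → ℕ) (K D : ℕ) (hK : 1 ≤ K)
    (β : ℕ → ℝ) (hβ0 : ∀ k, 0 ≤ β k) (hβ : ∑ k ∈ Finset.Icc 1 K, β k ≤ D) :
    ∃ k ∈ Finset.Icc 1 K,
      ∑ i, (1 / 2 : ℝ) ^ ((lev i - k) + (k - lev i)) ≤ 8 * (Fintype.card ι + 1) / K ∧
      β k ≤ 2 * (D + 1) / K := by
  set W : ℕ → ℝ := fun k => ∑ i, (1 / 2 : ℝ) ^ ((lev i - k) + (k - lev i)) with hW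
  have hW0 : ∀ k, 0 ≤ W k := fun k => Finset.sum_nonneg fun _ _ => by positivity
  have hWsum : ∑ k ∈ Finset.Icc 1 K, W k ≤ 4 * Fintype.card ι := by
    simp only [hW]
    rw [Finset.sum_comm]
    refine (Finset.sum_le_sum fun i _ => sum_half_pow_dist_le K (lev i)).trans ?_
    simp [mul_comm]
  set t : ℝ := (Fintype.card ι : ℝ) with ht
  have ht0 : 0 ≤ t := Nat.cast_nonneg _
  have hD0 : (0 : ℝ) ≤ D := Nat.cast_nonneg _
  have hK0 : (0 : ℝ) < K := by exact_mod_cast hK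
  -- Normalizing both quantities to total at most 1 lets one averaging argument find a scale good
  -- for both.
  have hsum : ∑ k ∈ Finset.Icc 1 K, (W k / (4 * (t + 1)) + β k / (D + 1)) ≤
      ∑ k ∈ Finset.Icc 1 K, 2 / (K : ℝ) := by
    rw [Finset.sum_add_distrib, ← Finset.sum_div, ← Finset.sum_div]
    have h1 : (∑ k ∈ Finset.Icc 1 K, W k) / (4 * (t + 1)) ≤ 1 := by
      rw [div_le_one (by positivity)]; linarith
    have h2 : (∑ k ∈ Finset.Icc 1 K, β k) / ((D : ℝ) + 1) ≤ 1 := by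
      rw [div_le_one (by positivity)]; linarith
    have h3 : ∑ k ∈ Finset.Icc 1 K, 2 / (K : ℝ) = 2 := by
      simp; field_simp
    linarith
  obtain ⟨k, hk, hle⟩ := Finset.exists_le_of_sum_le ⟨1, by simp [hK]⟩ hsum
  have h1 : 0 ≤ W k / (4 * (t + 1)) := div_nonneg (hW0 k) (by positivity)
  have h2 : 0 ≤ β k / ((D : ℝ) + 1) := div_nonneg (hβ0 k) (by positivity)
  refine ⟨k, hk, ?_, ?_⟩
  · have h3 : W k / (4 * (t + 1)) ≤ 2 / K := by linarith
    rw [div_le_iff₀ (by positivity)] at h3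
    refine h3.trans (le_of_eq ?_)
    ring
  · have h3 : β k / ((D : ℝ) + 1) ≤ 2 / K := by linarith
    rw [div_le_iff₀ (by positivity)] at h3
    refine h3.trans (le_of_eq ?_)
    ring

theorem two_pow_ge_of_large {L M : ℕ} (hL : 2000 ≤ L) (hM : 3 * L ≤ 4 * M) :
    16 * (L : ℝ) ^ 2 * Real.exp (L / 150) ≤ 2 ^ M := by
  have hL' : (2000 : ℝ) ≤ L := by exact_mod_cast hL
  have hM' : 3 * (L : ℝ) ≤ 4 * M := by exact_mod_cast hM
  have h1 : Real.exp ((L : ℝ) / 2) ≤ 2 ^ M := by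
    rw [← Real.rpow_natCast, Real.rpow_def_of_pos (by norm_num)]
    refine Real.exp_le_exp.2 ?_
    have := Real.log_two_gt_d9
    nlinarith
  have h2 : 16 * (L : ℝ) ^ 2 ≤ Real.exp (2 * L / 5) := by
    have h3 := Real.pow_div_factorial_le_exp (2 * (L : ℝ) / 5) (by positivity) 3
    refine le_trans ?_ h3
    norm_num [Nat.factorial]
    have : (0 : ℝ) ≤ (L : ℝ) ^ 2 := by positivity
    nlinarith
  calc 16 * (L : ℝ) ^ 2 * Real.exp (L / 150)
      ≤ Real.exp (2 * L / 5) * Real.exp (L / 150) :=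
        mul_le_mul_of_nonneg_right h2 (Real.exp_pos _).le
    _ = Real.exp (2 * L / 5 + L / 150) := (Real.exp_add _ _).symm
    _ ≤ Real.exp ((L : ℝ) / 2) := Real.exp_le_exp.2 (by linarith)
    _ ≤ 2 ^ M := h1

/-- With too few sets `A i`, there is a network size for which, with a not too small probability, no
`A i` contains exactly one sample, and for which `β` is small. -/
theorem exists_no_clear {S : Type*} [MeasurableSpace S] (μ : Measure S) [IsProbabilityMeasure μ]
    {ι : Type*} [Fintype ι] (A : ι → Set S) (hA : ∀ i, MeasurableSet (A i)) (L D : ℕ)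
    (hL : 2000 ≤ L) (hLD : 32 * (D + 1) ≤ L) (ht : (Fintype.card ι : ℝ) ≤ (L : ℝ) ^ 2 / 20000)
    (β : ℕ → ℝ) (hβ0 : ∀ j, 0 ≤ β j) (hβ : ∑ j ∈ Finset.Icc 1 L, β j ≤ D) :
    ∃ j ∈ Finset.Icc 1 L, L ≤ 2 ^ j ∧ β j ≤ 1 / 2 ∧ Real.exp (-(3 / 25 * L)) / 4 ≤
      (Measure.pi fun _ : Fin (2 ^ j) => μ).real {σ | ∀ i, ¬ ∃! v, σ v ∈ A i} := by
  classical
  have hL' : (2000 : ℝ) ≤ L := by exact_mod_cast hL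
  -- Scales up to `L / 4` keep the sizes `2 ^ (L - k)` above about `2 ^ (3 * L / 4)`, large enough
  -- for `∑ q i ≤ α` below.
  set K := L / 4 with hK
  have hK4 : 4 * K ≤ L := by omega
  have hK1 : 1 ≤ K := by omega
  have hK8 : L ≤ 8 * K := by omega
  have hK8' : (L : ℝ) ≤ 8 * K := by exact_mod_cast hK8
  have hK0 : (0 : ℝ) < K := by exact_mod_cast hK1
  -- Normalized so that at scale `k`, with `m = 2 ^ (L - k - 1)`, `m * θ l = 4 * 2 ^ (l - k)` as
  -- real powers.
  set θ : ℕ → ℝ := fun k => 8 * 2 ^ k / 2 ^ L with hθ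
  obtain ⟨lev, hlev, hprop⟩ := exists_levels μ A θ K
  have hβ' : ∑ k ∈ Finset.Icc 1 K, β (L - k) ≤ D := by
    refine le_trans ?_ hβ
    have hinj : Set.InjOn (fun k => L - k) (Finset.Icc 1 K : Finset ℕ) := by
      intro a ha b hb hab
      simp only [Finset.coe_Icc, Set.mem_Icc] at ha hb hab
      omega
    rw [← Finset.sum_image (f := β) hinj]
    refine Finset.sum_le_sum_of_subset_of_nonneg (fun j hj => ?_) fun j _ _ => hβ0 j
    obtain ⟨k, hk, rfl⟩ := Finset.mem_image.1 hj
    simp only [Finset.mem_Icc] at hk ⊢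
    omega
  obtain ⟨k, hk, hWk, hβk⟩ := exists_good_scale lev K D hK1 (fun k => β (L - k))
    (fun k => hβ0 _) hβ'
  obtain ⟨hk1, hkK⟩ := Finset.mem_Icc.1 hk
  set W : ℝ := ∑ i, (1 / 2 : ℝ) ^ ((lev i - k) + (k - lev i)) with hW
  set w : ℝ := L / 150 with hw
  have hWw : W ≤ w := by
    refine hWk.trans ?_
    rw [div_le_iff₀ hK0, hw]
    nlinarith
  set m := 2 ^ (L - k - 1) with hm
  have hn : 2 ^ (L - k) = m + m := by
    rw [hm, ← two_mul, ← pow_succ']; congr 1; omega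
  have hm0 : (0 : ℝ) < m := by positivity
  have hmk : (2 : ℝ) ^ L = 2 * m * 2 ^ k := by
    rw [hm]; push_cast
    rw [mul_assoc, ← pow_add, ← pow_succ']; congr 1; omega
  have hLn : L ≤ 2 ^ (L - k) := by
    have h := two_pow_ge_of_large (M := L - k) hL (by omega)
    have h1 : (1 : ℝ) ≤ Real.exp (L / 150) := Real.one_le_exp (by positivity)
    have h2 : (L : ℝ) ≤ 2 ^ (L - k) := by nlinarith
    exact_mod_cast h2
  have hLm : (L : ℝ) ≤ 2 * m := by
    have : ((L : ℕ) : ℝ) ≤ ((m + m : ℕ) : ℝ) := by exact_mod_cast hn ▸ hLn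
    push_cast at this; linarith
  refine ⟨L - k, Finset.mem_Icc.2 ⟨by omega, by omega⟩, hLn, ?_, ?_⟩
  · refine hβk.trans ?_
    rw [div_le_iff₀ hK0]
    have : (32 * ((D : ℝ) + 1)) ≤ L := by exact_mod_cast hLD
    linarith
  set T := Finset.univ.filter (fun i => lev i ≤ k) with hT
  have hTk := hprop k hkK
  rw [← hT] at hTk
  set q : ι → ℝ := fun i => θ (lev i - 1) with hq
  have hθ0 : ∀ k, 0 ≤ θ k := fun k => by simp only [hθ]; positivity
  have hTmem : ∀ i, i ∉ T ↔ k < lev i := fun i => by simp [hT]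
  -- Half of the lower bound `exp (-w)` for the product, so that subtracting `α` loses only a factor
  -- 2.
  set α : ℝ := Real.exp (-w) / 2 with hα
  have hα0 : 0 < α := by positivity
  have hexp1 : Real.exp (-w) ≤ 1 := Real.exp_le_one_iff.2 (by rw [hw, neg_nonpos]; positivity)
  have hα1 : α ≤ 1 := by rw [hα]; linarith
  have hqα : ∑ i ∈ Tᶜ, q i ≤ α := by
    have h1 : ∀ i ∈ Tᶜ, q i ≤ θ K := fun i _ => by
      simp only [hq, hθ]
      have : (2 : ℝ) ^ (lev i - 1) ≤ 2 ^ K :=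
        pow_le_pow_right₀ (by norm_num) (by have := (hlev i).2; omega)
      gcongr
    have h2 : ∑ i ∈ Tᶜ, q i ≤ (Fintype.card ι) * θ K := by
      refine (Finset.sum_le_card_nsmul _ _ _ h1).trans ?_
      rw [nsmul_eq_mul]
      exact mul_le_mul_of_nonneg_right (by exact_mod_cast Finset.card_le_univ _) (hθ0 K)
    have h3 := two_pow_ge_of_large (M := L - K) hL (by omega)
    have h4 : (2 : ℝ) ^ L = 2 ^ (L - K) * 2 ^ K := by rw [← pow_add]; congr 1; omega
    have h5 : θ K = 8 / 2 ^ (L - K) := by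
      simp only [hθ]; rw [h4]; field_simp
    refine h2.trans ?_
    rw [h5, hα, Real.exp_neg, mul_div_assoc', div_le_iff₀ (by positivity)]
    rw [← hw] at h3
    have h6 : (Fintype.card ι : ℝ) ≤ (L : ℝ) ^ 2 := ht.trans (by nlinarith)
    have h7 : 0 < Real.exp w := Real.exp_pos _
    have h8 : 16 * (L : ℝ) ^ 2 ≤ (Real.exp w)⁻¹ * 2 ^ (L - K) := by
      rw [inv_mul_eq_div, le_div_iff₀ h7]; exact h3
    linarith
  have hqlow : ∀ i ∉ T, q i ≤ μ.real (A i \ ⋃ i ∈ T, A i) := fun i hi =>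
    hTk.2 hk1 i ((hTmem i).1 hi)
  have hTm : MeasurableSet (⋃ i ∈ T, A i) := Finset.measurableSet_biUnion T fun i _ => hA i
  set x := μ.real (⋃ i ∈ T, A i) with hx
  have hx0 : 0 ≤ x := measureReal_nonneg
  -- A selected set contributes at most `4 * 2 ^ (-d)` to `m * x`, with `d = k - lev i`.
  have hxle : m * x ≤ 4 * W := by
    have h1 : ∑ i ∈ T, θ (lev i) ≤ 4 / m * W := by
      rw [hW, Finset.mul_sum]
      have h2 : ∀ i ∈ T, θ (lev i) = 4 / m * (1 / 2 : ℝ) ^ ((lev i - k) + (k - lev i)) := by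
        intro i hi
        have hik : lev i ≤ k := (Finset.mem_filter.1 hi).2
        have h3 : (lev i - k) + (k - lev i) = k - lev i := by omega
        have h4 : (2 : ℝ) ^ k = 2 ^ (k - lev i) * 2 ^ (lev i) := by
          rw [← pow_add]; congr 1; omega
        simp only [hθ]
        rw [h3, hmk, h4, one_div, inv_pow]
        field_simp; norm_num
      rw [Finset.sum_congr rfl h2]
      exact Finset.sum_le_sum_of_subset_of_nonneg (Finset.subset_univ _)
        fun i _ _ => by positivity
    have h2 := mul_le_mul_of_nonneg_left (hTk.1.trans h1) hm0.le
    refine h2.trans (le_of_eq ?_)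
    field_simp
  have hxhalf : x ≤ 1 / 2 := by
    by_contra! hlt
    have := mul_lt_mul_of_pos_left hlt hm0
    rw [hw] at hWw
    linarith
  have hρ : Real.exp (-(8 * w)) ≤ μ.real (⋃ i ∈ T, A i)ᶜ ^ m := by
    rw [probReal_compl_eq_one_sub hTm]
    refine le_trans ?_ (pow_le_pow_left₀ (Real.exp_pos _).le (exp_neg_two_mul_le hx0 hxhalf) m)
    rw [← Real.exp_nat_mul]
    exact Real.exp_le_exp.2 (by linarith)
  have hprod : Real.exp (-w) ≤ ∏ i ∈ Tᶜ, (1 - (1 - α) * (1 - q i / 2) ^ m) := by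
    have h1 : Real.exp (-w) ≤
        ∏ i ∈ Tᶜ, Real.exp (-(1 / 2 : ℝ) ^ ((lev i - k) + (k - lev i))) := by
      rw [← Real.exp_sum, Finset.sum_neg_distrib]
      refine Real.exp_le_exp.2 (neg_le_neg (le_trans ?_ hWw))
      exact Finset.sum_le_sum_of_subset_of_nonneg (Finset.subset_univ _)
        fun i _ _ => by positivity
    refine h1.trans (Finset.prod_le_prod (fun _ _ => (Real.exp_pos _).le) fun i hi => ?_)
    have hik : k < lev i := (hTmem i).1 (Finset.mem_compl.1 hi)
    have h3 : (lev i - k) + (k - lev i) = lev i - k := by omega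
    set y : ℝ := 2 ^ (lev i - k) with hy
    have hy0 : 0 < y := by positivity
    have h4 : (1 / 2 : ℝ) ^ (lev i - k) = y⁻¹ := by rw [one_div, inv_pow]
    have hqy : q i / 2 * m = y := by
      have h5 : (2 : ℝ) ^ (lev i - 1) * 2 = y * 2 ^ k := by
        rw [← pow_succ, hy, ← pow_add]; congr 1; omega
      simp only [hq, hθ]
      rw [hmk]
      field_simp
      linarith
    have hq1 : q i ≤ 1 := (hqlow i (Finset.mem_compl.1 hi)).trans measureReal_le_one
    have h6 : (1 - q i / 2) ^ m ≤ Real.exp (-y) := by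
      have h7 : 1 - q i / 2 ≤ Real.exp (-(q i / 2)) := by
        linarith [Real.add_one_le_exp (-(q i / 2))]
      refine (pow_le_pow_left₀ (by linarith) h7 m).trans (le_of_eq ?_)
      rw [← Real.exp_nat_mul]
      congr 1; linarith
    have h8 : 0 ≤ (1 - q i / 2) ^ m := pow_nonneg (by linarith) _
    rw [h3, h4]
    refine (exp_neg_inv_le hy0).trans ?_
    nlinarith
  -- Avoiding costs `exp (-8 w)` and hitting `exp (-w) / 2` per half. Squaring gives `exp (-18 w) /
  -- 4`, and `18 / 150 = 3 / 25`.
  have hb := pi_no_clear_ge μ hA T q (fun i => hθ0 _) hqlow hα0 hα1 hqα hn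
    (b := Real.exp (-(9 * w)) / 2) (by positivity) (by
      have h1 : Real.exp (-(9 * w)) / 2 = Real.exp (-(8 * w)) * (Real.exp (-w) / 2) := by
        rw [show -(9 * w) = -(8 * w) + -w by ring, Real.exp_add]; ring
      rw [h1]
      refine mul_le_mul hρ ?_ (by positivity) (by positivity)
      rw [hα]; linarith)
  refine le_trans (le_of_eq ?_) hb
  rw [div_pow, ← Real.exp_nat_mul]
  congr 1
  · congr 1
    rw [hw]; push_cast; ring
  · norm_num

/-- If success in a network with `2 ^ j` independent nodes requires a clear transmission in one of
few slots or that all seeds lie in `B j`, then the failure probabilities cannot all be tiny. -/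
theorem exp_le_sum_failure {S : Type*} [MeasurableSpace S] (μ : Measure S)
    [IsProbabilityMeasure μ] {ι : Type*} [Fintype ι] (A : ι → Set S) (B : ℕ → Set S) (L D : ℕ)
    (hL : 2000 ≤ L) (hLD : 32 * (D + 1) ≤ L) (ht : (Fintype.card ι : ℝ) ≤ (L : ℝ) ^ 2 / 20000)
    (hB : ∀ s, {j | j ∈ Finset.Icc 1 L ∧ s ∈ B j}.ncard ≤ D)
    (E : ∀ j : ℕ, Set (Fin (2 ^ j) → S)) (hEm : ∀ j ∈ Finset.Icc 1 L, MeasurableSet (E j))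
    (hE : ∀ j ∈ Finset.Icc 1 L, ∀ σ ∈ E j, (∃ i, ∃! v, σ v ∈ A i) ∨ ∀ v, σ v ∈ B j) :
    Real.exp (-(L / 4)) ≤
      ∑ j ∈ Finset.Icc 1 L, (Measure.pi fun _ : Fin (2 ^ j) => μ).real (E j)ᶜ := by
  classical
  obtain ⟨ρ, hρm, hρ⟩ := exists_measurable_model μ
    (Sum.elim A (fun x : Finset.Icc 1 L => B x))
  have hAm : ∀ i, MeasurableSet (ρ ⁻¹' A i) := fun i => hρm (Sum.inl i)
  set B' : ℕ → Set S := fun j => if j ∈ Finset.Icc 1 L then ρ ⁻¹' B j else ∅ with hB'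
  have hBm : ∀ j, MeasurableSet (B' j) := fun j => by
    by_cases hj : j ∈ Finset.Icc 1 L
    · simp only [hB', if_pos hj]; exact hρm (Sum.inr ⟨j, hj⟩)
    · simp only [hB', if_neg hj]; exact MeasurableSet.empty
  have hB'D : ∀ s, {j | j ∈ Finset.Icc 1 L ∧ s ∈ B' j}.ncard ≤ D := fun s => by
    have : {j | j ∈ Finset.Icc 1 L ∧ s ∈ B' j} = {j | j ∈ Finset.Icc 1 L ∧ ρ s ∈ B j} := by
      ext j
      simp only [Set.mem_ofPred_eq, hB']
      refine and_congr_right fun hj => ?_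
      rw [if_pos hj]; rfl
    rw [this]; exact hB (ρ s)
  obtain ⟨j, hj, hLj, hβj, hnc⟩ := exists_no_clear μ (fun i => ρ ⁻¹' A i) hAm L D hL hLD ht
    (fun j => μ.real (B' j)) (fun j => measureReal_nonneg)
    (sum_measureReal_le_of_card_le μ _ _ hBm hB'D)
  refine le_trans ?_ (Finset.single_le_sum (f := fun j =>
    (Measure.pi fun _ : Fin (2 ^ j) => μ).real (E j)ᶜ) (fun _ _ => measureReal_nonneg) hj)
  set P := Measure.pi fun _ : Fin (2 ^ j) => μ with hP
  have h1 : ∀ᵐ σ ∂P, σ ∈ E j → (fun v => ρ (σ v)) ∈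
      {σ : Fin (2 ^ j) → S | (∃ i, ∃! v, σ v ∈ A i) ∨ ∀ v, σ v ∈ B j} := by
    refine hρ _ (E j) _ (hEm j hj) ?_ (hE j hj)
    intro σ τ h
    have hA' : ∀ i v, σ v ∈ A i ↔ τ v ∈ A i := fun i v => h v (Sum.inl i)
    have hB' : ∀ v, σ v ∈ B j ↔ τ v ∈ B j := fun v => h v (Sum.inr ⟨j, hj⟩)
    simp [hA', hB']
  have h2 : P.real {σ | ∀ i, ¬ ∃! v, σ v ∈ ρ ⁻¹' A i} ≤
      P.real ((E j)ᶜ ∪ {σ | ∀ v, σ v ∈ B' j}) := by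
    refine ENNReal.toReal_mono (measure_ne_top _ _) (measure_mono_ae ?_)
    filter_upwards [h1] with σ hσ hσn
    by_cases hσE : σ ∈ E j
    · rcases hσ hσE with ⟨i, hi⟩ | hk
      · exact absurd hi (hσn i)
      · refine Or.inr fun v => ?_
        simp only [hB', if_pos hj]
        exact hk v
    · exact Or.inl hσE
  have h3 := h2.trans (measureReal_union_le _ _)
  rw [pi_forall_mem] at h3
  -- Since `β j ≤ 1 / 2` and there are at least `L` nodes, success without a clear transmission is
  -- negligible against `exp (-(3 / 25) L)`.
  have h4 : μ.real (B' j) ^ (2 ^ j) ≤ Real.exp (-(L / 2)) := by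
    calc μ.real (B' j) ^ (2 ^ j) ≤ (1 / 2) ^ (2 ^ j) :=
          pow_le_pow_left₀ measureReal_nonneg hβj _
      _ ≤ (1 / 2) ^ L := pow_le_pow_of_le_one (by norm_num) (by norm_num) hLj
      _ = Real.exp (-(L * Real.log 2)) := by
          rw [← Real.rpow_natCast, Real.rpow_def_of_pos (by norm_num), one_div, Real.log_inv]
          congr 1; ring
      _ ≤ Real.exp (-(L / 2)) := Real.exp_le_exp.2 (by
          have := Real.log_two_gt_d9
          have hL0 : (0 : ℝ) ≤ L := Nat.cast_nonneg _
          nlinarith)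
  have hL' : (2000 : ℝ) ≤ L := by exact_mod_cast hL
  have h5 : Real.exp (-(L / 2)) ≤ Real.exp (-((L : ℝ) / 4)) :=
    Real.exp_le_exp.2 (by linarith)
  have h6 : 8 * Real.exp (-((L : ℝ) / 4)) ≤ Real.exp (-(3 / 25 * L)) := by
    have h7 : Real.exp (-(3 / 25 * L)) =
        Real.exp (13 / 100 * L) * Real.exp (-((L : ℝ) / 4)) := by
      rw [← Real.exp_add]; congr 1; ring
    rw [h7]
    refine mul_le_mul_of_nonneg_right ?_ (Real.exp_pos _).le
    linarith [Real.add_one_le_exp (13 / 100 * (L : ℝ))]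
  linarith

/-! ### Histories without clear transmissions -/

/-- The patterns (newest slot first) of the bits telling in which of `i` slots noise was audible. -/
def patterns (cd : Bool) : ℕ → Finset (List Bool)
  | 0 => {[]}
  | i + 1 => (patterns cd i).image (List.cons false) ∪
      if cd then (patterns cd i).image (List.cons true) else ∅

theorem cons_mem_patterns {cd b : Bool} {i : ℕ} {ω : List Bool} (hω : ω ∈ patterns cd i)
    (hb : b = true → cd = true) : b :: ω ∈ patterns cd (i + 1) := by
  cases b with
  | false => exact Finset.mem_union_left _ (Finset.mem_image_of_mem _ hω)
  | true =>
    refine Finset.mem_union_right _ ?_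
    rw [if_pos (hb rfl)]
    exact Finset.mem_image_of_mem _ hω

theorem patterns_false (i : ℕ) : patterns false i = {List.replicate i false} := by
  induction i with
  | zero => rfl
  | succ i ih => simp [patterns, ih, List.replicate_succ]

theorem card_patterns_true_le (i : ℕ) : (patterns true i).card ≤ 2 ^ i := by
  induction i with
  | zero => simp [patterns]
  | succ i ih =>
    simp only [patterns, if_true]
    refine (Finset.card_union_le _ _).trans ?_
    have h1 := (patterns true i).card_image_le (f := List.cons false)
    have h2 := (patterns true i).card_image_le (f := List.cons true)
    rw [pow_succ]; omega

/-- The patterns for fewer than `t` slots. -/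
def patternsBelow (cd : Bool) (t : ℕ) : Finset (List Bool) :=
  (Finset.range t).biUnion (patterns cd)

theorem mem_patternsBelow {cd : Bool} {t i : ℕ} (hi : i < t) {ω : List Bool}
    (hω : ω ∈ patterns cd i) : ω ∈ patternsBelow cd t :=
  Finset.mem_biUnion.2 ⟨i, Finset.mem_range.2 hi, hω⟩

theorem card_patternsBelow_false_le (t : ℕ) : (patternsBelow false t).card ≤ t := by
  refine Finset.card_biUnion_le.trans ?_
  simp [patterns_false]

theorem card_patternsBelow_true_le (t : ℕ) : (patternsBelow true t).card ≤ 2 ^ t := by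
  refine Finset.card_biUnion_le.trans ((Finset.sum_le_sum fun i _ =>
    card_patterns_true_le i).trans ?_)
  have := Nat.geomSum_lt (n := t) (s := Finset.range t) (m := 2) le_rfl fun k hk =>
    Finset.mem_range.1 hk
  exact this.le

/-- The history of a node that never receives a message: it hears noise or silence according to the
pattern `ω` whenever it listens. -/
def silentHistory {R : Type} (A : Algorithm R) (r : R) (s : A.Seed) :
    List Bool → List (Feedback A.Msg)
  | [] => []
  | b :: ω => silentHistory A r s ω ++
      [if (A.act r s (silentHistory A r s ω)).isSome then .transmitting
        else if b then .noise else .silence]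

/-- The history of a leaf of a star whose center has the seed `s₀` and perceives the pattern `ω`. -/
def leafHistory (A : Algorithm Role) (s₀ s : A.Seed) : List Bool → List (Feedback A.Msg)
  | [] => []
  | _ :: ω => leafHistory A s₀ s ω ++
      [if (A.act .ordinary s (leafHistory A s₀ s ω)).isSome then .transmitting
        else match A.act .designated s₀ (silentHistory A .designated s₀ ω) with
          | some m => .message m
          | none => .silence]

theorem feedback_of_isSome {V M : Type} (cd : Bool) (G : SimpleGraph V) (a : V → Option M) (v : V)
    (h : (a v).isSome) : feedback cd G a v = .transmitting := by
  simp [feedback, h]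

theorem feedback_of_not_existsUnique {V M : Type} (cd : Bool) (G : SimpleGraph V)
    (a : V → Option M) (v : V) (h : ¬ (a v).isSome) (h' : ¬ ∃! u, G.Adj v u ∧ (a u).isSome)
    {b : Bool} (hb : b = true ↔ cd = true ∧ ∃ u, G.Adj v u ∧ (a u).isSome) :
    feedback cd G a v = if b then .noise else .silence := by
  rw [feedback, if_neg h, dif_neg h']
  simp only [← hb]

theorem feedback_of_unique {V M : Type} (cd : Bool) (G : SimpleGraph V) (a : V → Option M)
    (v u : V) (h : ¬ (a v).isSome) (hu : G.Adj v u) (huniq : ∀ x, G.Adj v x → x = u) {m : M}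
    (hm : a u = some m) : feedback cd G a v = .message m := by
  have h' : ∃! u, G.Adj v u ∧ (a u).isSome := ⟨u, ⟨hu, by simp [hm]⟩, fun x hx => huniq x hx.1⟩
  rw [feedback, if_neg h, dif_pos h']
  have h1 : h'.choose = u := huniq _ h'.choose_spec.1.1
  congr 1
  apply Option.some_injective
  rw [Option.some_get, h1, hm]

/-- In a clique without clear transmissions, histories are determined by the own seed and a common
pattern. -/
theorem history_clique {V : Type} (A : Algorithm Unit) (cd : Bool) (σ : V → A.Seed) (t : ℕ)
    (hσ : ∀ ω ∈ patternsBelow cd t,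
      ¬ ∃! v, (A.act () (σ v) (silentHistory A () (σ v) ω)).isSome) (i : ℕ) (hi : i ≤ t) :
    ∃ ω ∈ patterns cd i, ∀ v,
      history A cd ⊤ (fun _ => ()) σ i v = silentHistory A () (σ v) ω := by
  classical
  induction i with
  | zero => exact ⟨[], by simp [patterns], fun v => rfl⟩
  | succ i ih =>
    obtain ⟨ω, hω, hv⟩ := ih (by omega)
    set a : V → Option A.Msg := fun v => A.act () (σ v) (silentHistory A () (σ v) ω) with ha
    have hna : ¬ ∃! v, (a v).isSome := hσ ω (mem_patternsBelow (by omega) hω)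
    -- A listener does not broadcast itself, so it has a broadcasting neighbor exactly if anyone
    -- broadcasts. Broadcasters ignore the bit, hence one bit serves all nodes.
    refine ⟨decide (cd = true ∧ ∃ u, (a u).isSome) :: ω, cons_mem_patterns hω (by simp; tauto),
      fun v => ?_⟩
    simp only [history, silentHistory, hv]
    congr 2
    change feedback cd ⊤ a v = if (a v).isSome then _ else _
    by_cases h : (a v).isSome
    · rw [feedback_of_isSome _ _ _ _ h, if_pos h]
    · rw [if_neg h]
      have hadj : ∀ u, ((⊤ : SimpleGraph V).Adj v u ∧ (a u).isSome) ↔ (a u).isSome := by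
        intro u
        rw [SimpleGraph.top_adj]
        exact ⟨fun h => h.2, fun hu => ⟨fun hvu => h (hvu ▸ hu), hu⟩⟩
      refine feedback_of_not_existsUnique cd ⊤ a v h ?_ ?_
      · simpa only [hadj] using hna
      · simp only [hadj, decide_eq_true_eq]

/-- In a star in which never exactly one leaf transmits, the center perceives noise and silence only,
and the histories of the leaves are determined by their seeds and by the center. -/
theorem history_star {n : ℕ} (A : Algorithm Role) (cd : Bool) (role : Fin (n + 1) → Role)
    (h0 : role 0 = .designated) (hs : ∀ v : Fin n, role v.succ = .ordinary)
    (σ : Fin (n + 1) → A.Seed) (t : ℕ)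
    (hσ : ∀ ω ∈ patternsBelow cd t, ¬ ∃! v : Fin n,
      (A.act .ordinary (σ v.succ) (leafHistory A (σ 0) (σ v.succ) ω)).isSome)
    (i : ℕ) (hi : i ≤ t) :
    ∃ ω ∈ patterns cd i,
      history A cd (SimpleGraph.starGraph 0) role σ i 0 =
        silentHistory A .designated (σ 0) ω ∧
      ∀ v : Fin n, history A cd (SimpleGraph.starGraph 0) role σ i v.succ =
        leafHistory A (σ 0) (σ v.succ) ω := by
  classical
  induction i with
  | zero => exact ⟨[], by simp [patterns], rfl, fun v => rfl⟩
  | succ i ih =>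
    obtain ⟨ω, hω, hc, hl⟩ := ih (by omega)
    set G : SimpleGraph (Fin (n + 1)) := SimpleGraph.starGraph 0 with hG
    set a : Fin (n + 1) → Option A.Msg :=
      fun v => A.act (role v) (σ v) (history A cd G role σ i v) with ha
    have ha0 : a 0 = A.act .designated (σ 0) (silentHistory A .designated (σ 0) ω) := by
      simp only [ha, h0, hc]
    have hal : ∀ v : Fin n, a v.succ =
        A.act .ordinary (σ v.succ) (leafHistory A (σ 0) (σ v.succ) ω) := fun v => by
      simp only [ha, hs, hl]
    have hna : ¬ ∃! v : Fin n, (a v.succ).isSome := by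
      simpa only [hal] using hσ ω (mem_patternsBelow (by omega) hω)
    -- The bit records noise at the center. A leaf has one neighbor and never hears noise; its
    -- feedback is fixed by what the center does.
    refine ⟨decide (cd = true ∧ ∃ u : Fin n, (a u.succ).isSome) :: ω,
      cons_mem_patterns hω (by simp; tauto), ?_, fun v => ?_⟩
    · simp only [history, silentHistory, hc]
      congr 2
      change feedback cd G a 0 = _
      rw [← ha0]
      by_cases h : (a 0).isSome
      · rw [feedback_of_isSome _ _ _ _ h, if_pos h]
      · rw [if_neg h]
        have hadj : ∀ u : Fin n, G.Adj 0 u.succ := fun u => by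
          simp [hG, SimpleGraph.starGraph_adj, (Fin.succ_ne_zero u).symm]
        refine feedback_of_not_existsUnique cd G a 0 h ?_ ?_
        · rintro ⟨u, ⟨hu1, hu2⟩, huniq⟩
          obtain ⟨v, rfl⟩ := Fin.exists_succ_eq.2 hu1.ne'
          exact hna ⟨v, hu2, fun x hx => Fin.succ_injective _ (huniq x.succ ⟨hadj x, hx⟩)⟩
        · rw [decide_eq_true_eq]
          refine and_congr_right fun _ => ⟨?_, ?_⟩
          · rintro ⟨u, hu⟩
            exact ⟨u.succ, hadj u, hu⟩
          · rintro ⟨u, hu1, hu2⟩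
            obtain ⟨v, rfl⟩ := Fin.exists_succ_eq.2 hu1.ne'
            exact ⟨v, hu2⟩
    · simp only [history, leafHistory, hl]
      congr 2
      change feedback cd G a v.succ = _
      rw [← ha0, ← hal]
      by_cases h : (a v.succ).isSome
      · rw [feedback_of_isSome _ _ _ _ h, if_pos h]
      · rw [if_neg h]
        have hadj : G.Adj v.succ 0 := by
          simp [hG, SimpleGraph.starGraph_adj, Fin.succ_ne_zero v]
        have huniq : ∀ x, G.Adj v.succ x → x = 0 := fun x hx => by
          rw [hG, SimpleGraph.starGraph_adj] at hx
          exact hx.2.resolve_left (Fin.succ_ne_zero v)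
        cases h0 : a 0 with
        | some m => exact feedback_of_unique cd G a _ 0 h hadj huniq h0
        | none =>
          have hno : ∀ u, ¬ (G.Adj v.succ u ∧ (a u).isSome) := by
            rintro u ⟨hu1, hu2⟩
            rw [huniq u hu1, h0] at hu2
            simp at hu2
          exact feedback_of_not_existsUnique cd G a _ h (fun ⟨u, hu, _⟩ => hno u hu)
            (b := false) (by
              simp only [Bool.false_eq_true, false_iff]
              exact fun ⟨_, u, hu⟩ => hno u hu)

/-! ### Good estimates and neighbor counts -/

/-- An estimate is good for a bounded number of network sizes. -/
theorem ncard_good_le {c : ℝ} {D : ℕ} (hD : c < 2 ^ D) (f : ℕ → ℕ) (hf1 : ∀ j, 1 ≤ j → 1 ≤ f j)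
    (hf : ∀ j d, 2 ^ d * f j ≤ f (j + d)) (L : ℕ) (x : Option ℝ) :
    {j | j ∈ Finset.Icc 1 L ∧ ∃ e, x = some e ∧ IsGoodEstimate c (f j) e}.ncard ≤ D := by
  classical
  set X := {j | j ∈ Finset.Icc 1 L ∧ ∃ e, x = some e ∧ IsGoodEstimate c (f j) e} with hX
  rcases X.eq_empty_or_nonempty with h | h
  · simp [h]
  · have hmin := Nat.sInf_mem h
    -- Compared with the smallest good index `i`, a good `i + d` satisfies `2 ^ d * f i ≤ f (i + d)
    -- ≤ e ≤ c * f i`, so `d < D`.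
    set i := sInf X with hi
    have hsub : X ⊆ (Finset.Ico i (i + D) : Finset ℕ) := by
      intro j hj
      have hij : i ≤ j := Nat.sInf_le hj
      obtain ⟨d, rfl⟩ := Nat.exists_eq_add_of_le hij
      obtain ⟨hi1, e, he, _, hie⟩ := hmin
      obtain ⟨-, e', he', hje, _⟩ := hj
      obtain rfl : e = e' := Option.some_injective _ (he.symm.trans he')
      have h1 : (0 : ℝ) < f i := by exact_mod_cast hf1 i (Finset.mem_Icc.1 hi1).1
      have h2 : (2 : ℝ) ^ d * f i ≤ f (i + d) := by exact_mod_cast hf i d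
      have h3 : (2 : ℝ) ^ d ≤ c := le_of_mul_le_mul_right (h2.trans (hje.trans hie)) h1
      have h4 : d < D := (pow_lt_pow_iff_right₀ (by norm_num : (1 : ℝ) < 2)).1 (h3.trans_lt hD)
      simp only [Finset.coe_Ico, Set.mem_Ico]
      omega
    refine (Set.ncard_le_ncard hsub (Finset.finite_toSet _)).trans ?_
    rw [Set.ncard_coe_finset]; simp

theorem neighborCount_top {n : ℕ} (v : Fin n) :
    neighborCount (⊤ : SimpleGraph (Fin n)) v = n - 1 := by
  have : (⊤ : SimpleGraph (Fin n)).neighborSet v = {v}ᶜ := by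
    ext u; simp [eq_comm]
  rw [neighborCount, this, Set.ncard_compl, Set.ncard_singleton, Nat.card_fin]

theorem neighborCount_star_center (n : ℕ) :
    neighborCount (SimpleGraph.starGraph (0 : Fin (n + 1))) 0 = n := by
  have : (SimpleGraph.starGraph (0 : Fin (n + 1))).neighborSet 0 = {0}ᶜ := by
    ext u; simp [SimpleGraph.starGraph_adj, eq_comm]
  rw [neighborCount, this, Set.ncard_compl, Set.ncard_singleton, Nat.card_fin]
  rfl

theorem neighborCount_star_leaf {n : ℕ} (v : Fin n) :
    neighborCount (SimpleGraph.starGraph (0 : Fin (n + 1))) v.succ = 1 := by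
  have : (SimpleGraph.starGraph (0 : Fin (n + 1))).neighborSet v.succ = {0} := by
    ext u
    simp only [SimpleGraph.mem_neighborSet, SimpleGraph.starGraph_adj, Set.mem_singleton_iff,
      Fin.succ_ne_zero, false_or]
    exact ⟨fun h => h.2, fun h => ⟨h ▸ Fin.succ_ne_zero v, h⟩⟩
  rw [neighborCount, this, Set.ncard_singleton]

theorem HappensWithProb.le_real {V R : Type} [Fintype V] {A : Algorithm R} {p : ℝ}
    {E : Set (V → A.Seed)} (h : HappensWithProb A p E) :
    p ≤ (Measure.pi fun _ : V => A.law).real E :=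
  (ENNReal.ofReal_le_iff_le_toReal (measure_ne_top _ _)).1 h.2

/-! ### Single-hop networks -/

/-- The success event in the clique with `2 ^ j` nodes. -/
def cliqueSuccess (A : Algorithm Unit) (cd : Bool) (c : ℝ) (t j : ℕ) :
    Set (Fin (2 ^ j) → A.Seed) :=
  {σ | ∃ e : ℝ, ∀ v, estimate A cd ⊤ (fun _ => ()) σ t v = some e ∧
    IsGoodEstimate c (neighborCount (⊤ : SimpleGraph (Fin (2 ^ j))) v) e}

theorem SolvesSingleHop.happens {A : Algorithm Unit} {cd : Bool} {c : ℝ} {N t : ℕ} {p : ℝ}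
    (h : SolvesSingleHop A cd c N t p) {L : ℕ} (hL : 2 ^ L ≤ N) {j : ℕ}
    (hj : j ∈ Finset.Icc 1 L) : HappensWithProb A p (cliqueSuccess A cd c t j) := by
  obtain ⟨h1, h2⟩ := Finset.mem_Icc.1 hj
  refine h (Fin (2 ^ j)) ?_ ?_ ⟨j, Fintype.card_fin _⟩
  · rw [Fintype.card_fin]
    exact Nat.le_self_pow (by omega) 2
  · rw [Fintype.card_fin]
    exact (Nat.pow_le_pow_right (by norm_num) h2).trans hL

/-- The seeds with which a node of the clique with `2 ^ j` nodes has a good estimate after the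
pattern `ω`. -/
def goodSeeds (A : Algorithm Unit) (c : ℝ) (ω : List Bool) (j : ℕ) : Set A.Seed :=
  {s | ∃ e : ℝ, A.est () s (silentHistory A () s ω) = some e ∧ IsGoodEstimate c (2 ^ j - 1 : ℕ) e}

/-- The sets in both alternatives are built from silent histories. The broadcasting sets do not
mention `j`, which is what permits summation over sizes. -/
theorem cliqueSuccess_cases (A : Algorithm Unit) (cd : Bool) (c : ℝ) (t j : ℕ)
    (σ : Fin (2 ^ j) → A.Seed) (hσ : σ ∈ cliqueSuccess A cd c t j) :
    (∃ ω : patternsBelow cd t, ∃! v, σ v ∈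
      {s | (A.act () s (silentHistory A () s ω)).isSome}) ∨
    ∃ ω : patterns cd t, ∀ v, σ v ∈ goodSeeds A c ω j := by
  by_cases h : ∃ ω : patternsBelow cd t, ∃! v, σ v ∈
      {s | (A.act () s (silentHistory A () s ω)).isSome}
  · exact Or.inl h
  · obtain ⟨ω, hω, hv⟩ := history_clique A cd σ t (fun ω hω hu => h ⟨⟨ω, hω⟩, hu⟩) t le_rfl
    obtain ⟨e, he⟩ := hσ
    refine Or.inr ⟨⟨ω, hω⟩, fun v => ⟨e, ?_, ?_⟩⟩
    · rw [← hv v]; exact (he v).1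
    · have := (he v).2
      rwa [neighborCount_top] at this

theorem ncard_goodSeeds_le (A : Algorithm Unit) {c : ℝ} {D : ℕ} (hD : c < 2 ^ D) (ω : List Bool)
    (L : ℕ) (s : A.Seed) : {j | j ∈ Finset.Icc 1 L ∧ s ∈ goodSeeds A c ω j}.ncard ≤ D := by
  refine ncard_good_le hD (fun j => 2 ^ j - 1) (fun j hj => ?_) (fun j d => ?_) L
    (A.est () s (silentHistory A () s ω))
  · have := Nat.pow_le_pow_right (n := 2) (by norm_num) hj
    omega
  · rw [Nat.mul_sub, mul_one, ← pow_add, add_comm d j]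
    have : 1 ≤ 2 ^ d := Nat.one_le_two_pow
    omega

theorem SolvesSingleHop.mul_le {A : Algorithm Unit} {cd : Bool} {c : ℝ} {N t : ℕ} {p : ℝ}
    (h : SolvesSingleHop A cd c N t p) {L D : ℕ} (hL : 2 ^ L ≤ N) (hD : c < 2 ^ D) :
    p * L ≤ 2 * (patternsBelow cd t).card + D * (patterns cd t).card := by
  have h1 := sum_success_le A.law
    (fun ω : patternsBelow cd t => {s | (A.act () s (silentHistory A () s ω)).isSome})
    (fun (ω : patterns cd t) j => goodSeeds A c ω j) L D
    (fun ω s => ncard_goodSeeds_le A hD ω L s) (cliqueSuccess A cd c t)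
    (fun j hj => (h.happens hL hj).1) (fun j _ σ hσ => cliqueSuccess_cases A cd c t j σ hσ)
  rw [Fintype.card_coe, Fintype.card_coe] at h1
  refine le_trans ?_ h1
  have h2 := Finset.card_nsmul_le_sum (Finset.Icc 1 L) _ p fun j hj => (h.happens hL hj).le_real
  rw [nsmul_eq_mul, Nat.card_Icc, add_tsub_cancel_right, mul_comm] at h2
  exact h2

theorem SolvesSingleHop.exp_le {A : Algorithm Unit} {c : ℝ} {N t : ℕ} {p : ℝ}
    (h : SolvesSingleHop A false c N t p) {L D : ℕ} (hL : 2 ^ L ≤ N) (hD : c < 2 ^ D)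
    (hL0 : 2000 ≤ L) (hLD : 32 * (D + 1) ≤ L) (ht : (t : ℝ) ≤ (L : ℝ) ^ 2 / 20000) :
    Real.exp (-(L / 4)) ≤ L * (1 - p) := by
  refine (exp_le_sum_failure A.law
    (fun ω : patternsBelow false t => {s | (A.act () s (silentHistory A () s ω)).isSome})
    (goodSeeds A c (List.replicate t false)) L D hL0 hLD ?_ (ncard_goodSeeds_le A hD _ L)
    (cliqueSuccess A false c t) (fun j hj => (h.happens hL hj).1) fun j _ σ hσ => ?_).trans ?_
  · rw [Fintype.card_coe]
    exact le_trans (by exact_mod_cast card_patternsBelow_false_le t) ht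
  · refine (cliqueSuccess_cases A false c t j σ hσ).imp_right ?_
    rintro ⟨⟨ω, hω⟩, hv⟩
    rw [patterns_false, Finset.mem_singleton] at hω
    subst hω
    exact hv
  · refine (Finset.sum_le_card_nsmul _ _ (1 - p) fun j hj => ?_).trans ?_
    · rw [probReal_compl_eq_one_sub (h.happens hL hj).1]
      linarith [(h.happens hL hj).le_real]
    · simp

/-! ### Designated node in a star -/

/-- The success event in the star with `2 ^ j` leaves. -/
def starSuccess (A : Algorithm Role) (cd : Bool) (c : ℝ) (t j : ℕ) :
    Set (Fin (2 ^ j + 1) → A.Seed) :=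
  {σ | ∃ e : ℝ, estimate A cd (SimpleGraph.starGraph 0)
    (fun v => if v = 0 then Role.designated else Role.ordinary) σ t 0 = some e ∧
    IsGoodEstimate c (neighborCount (SimpleGraph.starGraph (0 : Fin (2 ^ j + 1))) 0) e}

theorem SolvesDesignated.happens {A : Algorithm Role} {cd : Bool} {c : ℝ} {N t : ℕ} {p : ℝ}
    (h : SolvesDesignated A cd c N t p) {L : ℕ} (hL : 2 ^ L ≤ N) {j : ℕ}
    (hj : j ∈ Finset.Icc 1 L) : HappensWithProb A p (starSuccess A cd c t j) := by
  obtain ⟨h1, h2⟩ := Finset.mem_Icc.1 hj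
  have hjN : 2 ^ j ≤ N := (Nat.pow_le_pow_right (by norm_num) h2).trans hL
  have key := h (Fin (2 ^ j + 1)) (SimpleGraph.starGraph 0) 0 (SimpleGraph.connected_starGraph 0) ?_
    ⟨j, neighborCount_star_center _⟩
  · unfold starSuccess
    convert key
  · intro v
    refine Fin.cases ?_ (fun v => ?_) v
    · rw [neighborCount_star_center]; exact hjN
    · rw [neighborCount_star_leaf]
      exact Nat.one_le_two_pow.trans hjN

/-- All seeds, if the center of a star with `2 ^ j` leaves has a good estimate after the pattern `ω`
when its seed is `s₀`; otherwise none. -/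
def centerGood (A : Algorithm Role) (c : ℝ) (s₀ : A.Seed) (ω : List Bool) (j : ℕ) : Set A.Seed :=
  {_s | ∃ e : ℝ, A.est .designated s₀ (silentHistory A .designated s₀ ω) = some e ∧
    IsGoodEstimate c (2 ^ j : ℕ) e}

theorem starSuccess_cases (A : Algorithm Role) (cd : Bool) (c : ℝ) (t j : ℕ) (s₀ : A.Seed)
    (σ : Fin (2 ^ j) → A.Seed)
    (hσ : (Fin.cons s₀ σ : Fin (2 ^ j + 1) → A.Seed) ∈ starSuccess A cd c t j) :
    (∃ ω : patternsBelow cd t, ∃! v, σ v ∈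
      {s | (A.act .ordinary s (leafHistory A s₀ s ω)).isSome}) ∨
    ∃ ω : patterns cd t, ∀ v, σ v ∈ centerGood A c s₀ ω j := by
  by_cases h : ∃ ω : patternsBelow cd t, ∃! v, σ v ∈
      {s | (A.act .ordinary s (leafHistory A s₀ s ω)).isSome}
  · exact Or.inl h
  · obtain ⟨ω, hω, hc, -⟩ := history_star A cd
      (fun v => open Classical in if v = 0 then Role.designated else Role.ordinary)
      (by simp) (by simp [Fin.succ_ne_zero]) (Fin.cons s₀ σ) t
      (fun ω hω hu => h ⟨⟨ω, hω⟩, by simpa using hu⟩) t le_rfl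
    obtain ⟨e, he, hgood⟩ := hσ
    rw [neighborCount_star_center] at hgood
    refine Or.inr ⟨⟨ω, hω⟩, fun v => ⟨e, ?_, hgood⟩⟩
    simp only [estimate, hc] at he
    simpa using he

theorem ncard_centerGood_le (A : Algorithm Role) {c : ℝ} {D : ℕ} (hD : c < 2 ^ D) (s₀ : A.Seed)
    (ω : List Bool) (L : ℕ) (s : A.Seed) :
    {j | j ∈ Finset.Icc 1 L ∧ s ∈ centerGood A c s₀ ω j}.ncard ≤ D :=
  ncard_good_le hD (fun j => 2 ^ j) (fun _ _ => Nat.one_le_two_pow)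
    (fun j d => by rw [← pow_add, add_comm]) L
    (A.est .designated s₀ (silentHistory A .designated s₀ ω))

/-- The bound holds for each fixed seed `s₀` of the center, with sets depending on `s₀`, and is then
integrated over `s₀`. -/
theorem SolvesDesignated.mul_le {A : Algorithm Role} {cd : Bool} {c : ℝ} {N t : ℕ} {p : ℝ}
    (h : SolvesDesignated A cd c N t p) {L D : ℕ} (hL : 2 ^ L ≤ N) (hD : c < 2 ^ D) :
    p * L ≤ 2 * (patternsBelow cd t).card + D * (patterns cd t).card := by
  have h1 : ∀ s₀ : A.Seed, ∑ j ∈ Finset.Icc 1 L, (Measure.pi fun _ : Fin (2 ^ j) => A.law).real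
      {σ | (Fin.cons s₀ σ : Fin (2 ^ j + 1) → A.Seed) ∈ starSuccess A cd c t j} ≤
      2 * (patternsBelow cd t).card + D * (patterns cd t).card := by
    intro s₀
    have := sum_success_le A.law
      (fun ω : patternsBelow cd t => {s | (A.act .ordinary s (leafHistory A s₀ s ω)).isSome})
      (fun (ω : patterns cd t) j => centerGood A c s₀ ω j) L D
      (fun ω s => ncard_centerGood_le A hD s₀ ω L s)
      (fun j => {σ | (Fin.cons s₀ σ : Fin (2 ^ j + 1) → A.Seed) ∈ starSuccess A cd c t j})
      (fun j hj => measurableSet_cons_section (h.happens hL hj).1 s₀)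
      (fun j _ σ hσ => starSuccess_cases A cd c t j s₀ σ hσ)
    rwa [Fintype.card_coe, Fintype.card_coe] at this
  have h2 := Finset.card_nsmul_le_sum (Finset.Icc 1 L) _ p fun j hj => (h.happens hL hj).le_real
  rw [nsmul_eq_mul, Nat.card_Icc, add_tsub_cancel_right, mul_comm] at h2
  have hint := fun j hj => pi_fin_succ_real_eq A.law (h.happens hL (j := j) hj).1
  refine h2.trans ?_
  rw [Finset.sum_congr rfl fun j hj => (hint j hj).2,
    ← integral_finsetSum _ fun j hj => (hint j hj).1]
  refine (integral_mono (integrable_finsetSum _ fun j hj => (hint j hj).1)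
    (integrable_const _) h1).trans ?_
  simp

theorem SolvesDesignated.exp_le {A : Algorithm Role} {c : ℝ} {N t : ℕ} {p : ℝ}
    (h : SolvesDesignated A false c N t p) {L D : ℕ} (hL : 2 ^ L ≤ N) (hD : c < 2 ^ D)
    (hL0 : 2000 ≤ L) (hLD : 32 * (D + 1) ≤ L) (ht : (t : ℝ) ≤ (L : ℝ) ^ 2 / 20000) :
    Real.exp (-(L / 4)) ≤ L * (1 - p) := by
  have h1 : ∀ s₀ : A.Seed, Real.exp (-(L / 4)) ≤
      ∑ j ∈ Finset.Icc 1 L, (Measure.pi fun _ : Fin (2 ^ j) => A.law).real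
        {σ | (Fin.cons s₀ σ : Fin (2 ^ j + 1) → A.Seed) ∈ (starSuccess A false c t j)ᶜ} := by
    intro s₀
    refine exp_le_sum_failure A.law
      (fun ω : patternsBelow false t => {s | (A.act .ordinary s (leafHistory A s₀ s ω)).isSome})
      (centerGood A c s₀ (List.replicate t false)) L D hL0 hLD ?_
      (ncard_centerGood_le A hD s₀ _ L)
      (fun j => {σ | (Fin.cons s₀ σ : Fin (2 ^ j + 1) → A.Seed) ∈ starSuccess A false c t j})
      (fun j hj => measurableSet_cons_section (h.happens hL hj).1 s₀) fun j _ σ hσ => ?_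
    · rw [Fintype.card_coe]
      exact le_trans (by exact_mod_cast card_patternsBelow_false_le t) ht
    · refine (starSuccess_cases A false c t j s₀ σ hσ).imp_right ?_
      rintro ⟨⟨ω, hω⟩, hv⟩
      rw [patterns_false, Finset.mem_singleton] at hω
      subst hω
      exact hv
  have hint := fun j hj => pi_fin_succ_real_eq A.law (h.happens hL (j := j) hj).1.compl
  have h2 : Real.exp (-(L / 4)) ≤ ∑ j ∈ Finset.Icc 1 L,
      (Measure.pi fun _ : Fin (2 ^ j + 1) => A.law).real (starSuccess A false c t j)ᶜ := by
    rw [Finset.sum_congr rfl fun j hj => (hint j hj).2,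
      ← integral_finsetSum _ fun j hj => (hint j hj).1]
    refine le_trans (le_of_eq ?_) (integral_mono (integrable_const _)
      (integrable_finsetSum _ fun j hj => (hint j hj).1) h1)
    simp
  refine h2.trans ((Finset.sum_le_card_nsmul _ _ (1 - p) fun j hj => ?_).trans ?_)
  · rw [probReal_compl_eq_one_sub (h.happens hL hj).1]
    linarith [(h.happens hL hj).le_real]
  · simp

/-! ### From finite bounds to asymptotic ones -/

theorem logb_two_bounds {N : ℕ} (hN : 1 ≤ N) :
    2 ^ Nat.log 2 N ≤ N ∧ (Nat.log 2 N : ℝ) ≤ Real.logb 2 N ∧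
      Real.logb 2 N ≤ Nat.log 2 N + 1 := by
  have hN0 : (0 : ℝ) < N := by exact_mod_cast hN
  have h1 : 2 ^ Nat.log 2 N ≤ N := Nat.pow_log_le_self 2 (by omega)
  have h2 : N < 2 ^ (Nat.log 2 N + 1) := Nat.lt_pow_succ_log_self (by norm_num) N
  refine ⟨h1, ?_, ?_⟩
  · rw [Real.le_logb_iff_rpow_le (by norm_num) hN0, Real.rpow_natCast]
    exact_mod_cast h1
  · rw [Real.logb_le_iff_le_rpow (by norm_num) hN0, ← Nat.cast_add_one, Real.rpow_natCast]
    exact_mod_cast h2.le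

theorem le_logb_of_two_pow_le {M N : ℕ} (h : 2 ^ M ≤ N) : (M : ℝ) ≤ Real.logb 2 N := by
  have hN0 : (0 : ℝ) < N := by exact_mod_cast (Nat.one_le_two_pow (n := M)).trans h
  rw [Real.le_logb_iff_rpow_le (by norm_num) hN0, Real.rpow_natCast]
  exact_mod_cast h

theorem requiresOmega_log {solvable : ℕ → ℕ → Prop} {p : ℝ} (hp : 0 < p) (D : ℕ)
    (h : ∀ N t, solvable N t → ∀ L : ℕ, 2 ^ L ≤ N → p * L ≤ 2 * t + D) :
    RequiresOmega solvable fun N => Real.logb 2 N := by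
  -- Beyond this threshold the additive loss `p + D` is at most half of `p * logb 2 N`.
  obtain ⟨M, hM⟩ := exists_nat_ge (2 * (p + D) / p)
  refine ⟨p / 4, by positivity, 2 ^ M, fun N hN t hs => ?_⟩
  have hN1 : 1 ≤ N := Nat.one_le_two_pow.trans hN
  obtain ⟨h1, -, h2⟩ := logb_two_bounds hN1
  have h3 := h N t hs _ h1
  have h4 := le_logb_of_two_pow_le hN
  have h5 := hM.trans h4
  rw [div_le_iff₀ hp] at h5
  have h6 := mul_le_mul_of_nonneg_left h2 hp.le
  linarith

theorem requiresOmega_loglog {solvable : ℕ → ℕ → Prop} {p : ℝ} (hp : 0 < p) (D : ℕ)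
    (h : ∀ N t, solvable N t → ∀ L : ℕ, 2 ^ L ≤ N → p * L ≤ (2 + D) * 2 ^ t) :
    RequiresOmega solvable fun N => Real.logb 2 (Real.logb 2 N) := by
  set a : ℝ := p / (2 * (2 + D)) with ha
  have ha0 : 0 < a := by positivity
  -- The 2 absorbs the rounding of the logarithm; the other term makes the constant `logb 2 a` cost
  -- at most half of the double logarithm.
  obtain ⟨M, hM⟩ := exists_nat_ge (max 2 (2 ^ (-(2 * Real.logb 2 a)) : ℝ))
  refine ⟨1 / 2, by norm_num, 2 ^ M, fun N hN t hs => ?_⟩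
  have hN1 : 1 ≤ N := Nat.one_le_two_pow.trans hN
  obtain ⟨h1, -, h2⟩ := logb_two_bounds hN1
  have h3 := h N t hs _ h1
  have h4 := le_logb_of_two_pow_le hN
  have h5 := hM.trans h4
  set x := Real.logb 2 (N : ℝ) with hx
  have hx2 : 2 ≤ x := (le_max_left _ _).trans h5
  have hx0 : 0 < x := by linarith
  have h6 : -(2 * Real.logb 2 a) ≤ Real.logb 2 x := by
    rw [Real.le_logb_iff_rpow_le (by norm_num) hx0]
    exact (le_max_right _ _).trans h5
  have h7 : a * x ≤ 2 ^ (t : ℝ) := by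
    rw [Real.rpow_natCast, ha, div_mul_eq_mul_div, div_le_iff₀ (by positivity)]
    have := mul_le_mul_of_nonneg_left h2 hp.le
    have := mul_le_mul_of_nonneg_left hx2 hp.le
    linarith
  have h8 : Real.logb 2 (a * x) ≤ t := by
    rwa [Real.logb_le_iff_le_rpow (by norm_num) (by positivity)]
  rw [Real.logb_mul ha0.ne' hx0.ne'] at h8
  linarith

/-- As `γ ≥ 1`, the allowed failure is at most `1 / N`, hence at most `exp (-(L / 2))`. Even
multiplied by `L` this is below `exp (-(L / 4))`, so `t` cannot be small. -/
theorem requiresOmega_log_sq {solvable : ℕ → ℕ → Prop} {γ : ℝ} (hγ : 1 ≤ γ) (D : ℕ)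
    (h : ∀ N t, solvable N t → ∀ L : ℕ, 2 ^ L ≤ N → 2000 ≤ L → 32 * (D + 1) ≤ L →
      (t : ℝ) ≤ (L : ℝ) ^ 2 / 20000 → Real.exp (-(L / 4)) ≤ L * (1 - highProb γ N)) :
    RequiresOmega solvable fun N => Real.logb 2 N ^ 2 := by
  refine ⟨1 / 80000, by norm_num, 2 ^ (2000 + 32 * (D + 1)), fun N hN t hs => ?_⟩
  have hN1 : 1 ≤ N := Nat.one_le_two_pow.trans hN
  obtain ⟨h1, h0, h2⟩ := logb_two_bounds hN1
  have hML : 2000 + 32 * (D + 1) ≤ Nat.log 2 N := by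
    have := Nat.log_mono_right (b := 2) hN
    rwa [Nat.log_pow (by norm_num)] at this
  set L := Nat.log 2 N with hL
  have hL' : (2000 : ℝ) ≤ L := by exact_mod_cast (by omega : 2000 ≤ L)
  by_contra! hlt
  have ht : (t : ℝ) ≤ (L : ℝ) ^ 2 / 20000 := by
    have : Real.logb 2 (N : ℝ) ^ 2 ≤ (2 * L) ^ 2 := pow_le_pow_left₀ (by linarith) (by linarith) 2
    nlinarith
  have h3 := h N t hs L h1 (by omega) (by omega) ht
  have h4 : 1 - highProb γ N ≤ Real.exp (-(L / 2)) := by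
    have hN1' : (1 : ℝ) ≤ N := by exact_mod_cast hN1
    have h5 : Real.exp ((L : ℝ) / 2) ≤ N := by
      have h6 : (2 : ℝ) ^ L ≤ N := by exact_mod_cast h1
      refine le_trans ?_ h6
      rw [← Real.rpow_natCast, Real.rpow_def_of_pos (by norm_num)]
      refine Real.exp_le_exp.2 ?_
      have := Real.log_two_gt_d9
      nlinarith
    have h7 : (N : ℝ) ≤ (N : ℝ) ^ γ := by
      simpa using Real.rpow_le_rpow_of_exponent_le hN1' hγ
    rw [highProb, sub_sub_cancel, Real.exp_neg, ← one_div]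
    exact one_div_le_one_div_of_le (Real.exp_pos _) (h5.trans h7)
  have h8 : Real.exp (-((L : ℝ) / 4)) = Real.exp (L / 4) * Real.exp (-(L / 2)) := by
    rw [← Real.exp_add]; congr 1; ring
  have h9 : (L : ℝ) < Real.exp (L / 4) := by
    have := Real.quadratic_le_exp_of_nonneg (x := (L : ℝ) / 4) (by positivity)
    nlinarith
  have h10 := mul_lt_mul_of_pos_right h9 (Real.exp_pos (-((L : ℝ) / 2)))
  have h11 := mul_le_mul_of_nonneg_left h4 (Nat.cast_nonneg (α := ℝ) L)
  linarith

theorem slots_bound_false (t D : ℕ) :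
    2 * ((patternsBelow false t).card : ℝ) + D * (patterns false t).card ≤ 2 * t + D := by
  have h1 : ((patternsBelow false t).card : ℝ) ≤ t := by
    exact_mod_cast card_patternsBelow_false_le t
  rw [patterns_false, Finset.card_singleton]
  push_cast
  linarith

theorem slots_bound_true (t D : ℕ) :
    2 * ((patternsBelow true t).card : ℝ) + D * (patterns true t).card ≤ (2 + D) * 2 ^ t := by
  have h1 : ((patternsBelow true t).card : ℝ) ≤ 2 ^ t := by
    exact_mod_cast card_patternsBelow_true_le t
  have h2 : ((patterns true t).card : ℝ) ≤ 2 ^ t := by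
    exact_mod_cast card_patterns_true_le t
  have h3 := mul_le_mul_of_nonneg_left h2 (Nat.cast_nonneg (α := ℝ) D)
  linarith

end RadioCounting


theorem mainTheorem1 (c : ℝ) (hc : 1 ≤ c) :
    -- single-hop networks with at most `N` nodes
    ((∀ p : ℝ, 0 < p → RadioCounting.RequiresOmega
        (fun N t => ∃ A, RadioCounting.SolvesSingleHop A false c N t p)
        (fun N => Real.logb 2 N)) ∧
      (∀ γ : ℝ, 1 ≤ γ → RadioCounting.RequiresOmega
        (fun N t => ∃ A, RadioCounting.SolvesSingleHop A false c N t (RadioCounting.highProb γ N))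
        (fun N => Real.logb 2 N ^ 2)) ∧
      (∀ p : ℝ, 0 < p → RadioCounting.RequiresOmega
        (fun N t => ∃ A, RadioCounting.SolvesSingleHop A true c N t p)
        (fun N => Real.logb 2 (Real.logb 2 N)))) ∧
    -- multi-hop networks with a designated node, at most `N` neighbors
    ((∀ p : ℝ, 0 < p → RadioCounting.RequiresOmega
        (fun N t => ∃ A, RadioCounting.SolvesDesignated A false c N t p)
        (fun N => Real.logb 2 N)) ∧
      (∀ γ : ℝ, 1 ≤ γ → RadioCounting.RequiresOmega
        (fun N t => ∃ A, RadioCounting.SolvesDesignated A false c N t (RadioCounting.highProb γ N))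
        (fun N => Real.logb 2 N ^ 2)) ∧
      (∀ p : ℝ, 0 < p → RadioCounting.RequiresOmega
        (fun N t => ∃ A, RadioCounting.SolvesDesignated A true c N t p)
        (fun N => Real.logb 2 (Real.logb 2 N)))) := by

  obtain ⟨D, hD⟩ := pow_unbounded_of_one_lt c (by norm_num : (1 : ℝ) < 2)
  open RadioCounting in
  exact ⟨⟨fun p hp => requiresOmega_log hp D fun N t ⟨A, h⟩ L hL =>
        (h.mul_le hL hD).trans (slots_bound_false t D),
      fun γ hγ => requiresOmega_log_sq hγ D fun N t ⟨A, h⟩ L hL h1 h2 h3 =>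
        h.exp_le hL hD h1 h2 h3,
      fun p hp => requiresOmega_loglog hp D fun N t ⟨A, h⟩ L hL =>
        (h.mul_le hL hD).trans (slots_bound_true t D)⟩,
    ⟨fun p hp => requiresOmega_log hp D fun N t ⟨A, h⟩ L hL =>
        (h.mul_le hL hD).trans (slots_bound_false t D),
      fun γ hγ => requiresOmega_log_sq hγ D fun N t ⟨A, h⟩ L hL h1 h2 h3 =>
        h.exp_le hL hD h1 h2 h3,
      fun p hp => requiresOmega_loglog hp D fun N t ⟨A, h⟩ L hL =>
        (h.mul_le hL hD).trans (slots_bound_true t D)⟩⟩
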